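/- **Proposition 2.1.** Let $k$ be a commutative ring and $G$ a group; $\otimes$ means $\otimes_k$, and $k$-algebras are associative but need not have a unit. *Conventions.* For a $k$-algebra $A$, a left $A$-module $M$ (a $k$-module on which $A$ acts $k$-bilinearly) is *unital* if the canonical map $A\otimes_A M\to M$ is an isomorphism, and similarly for right modules; $A$ is *unital* if $A\otimes_A A\to A$ is an isomorphism. Write $A^{\rm e}=A\otimes A^{\rm op}$; it acts on $A$ by $(a\otimes b)x=axb$. A *Taylor–Azumaya algebra* is a unital $k$-algebra $A$, faithful as a $k$-module, such that the adjoint functors $N\mapsto A\otimes N$, from $k$-modules to unital left $A^{\rm e}$-modules, and $M\mapsto \mathrm{Hom}_{A^{\rm e}}(A,M)$ in the other direction are inverse equivalences (the unit and the counit of the adjunction are isomorphisms). A *$G$-module algebra* is a $k$-algebra on which $G$ acts by $k$-algebra automorphisms; tensor products carry the diagonal action, opposite algebras the same action. A *$G$-module Taylor–Azumaya algebra* is a Taylor–Azumaya algebra that is also a $G$-module algebra. A *dual pair of $G$-modules* $\underline M=(M,M',\mu)$ consists of $k$-modules $M,M'$ with $k$-linear $G$-actions and a surjective $k$-linear map $\mu:M'\otimes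 M\to k$ with $\mu(g m'\otimes g m)=\mu(m'\otimes m)$ for all $g\in G$, $m\in M$, $m'\in M'$. Its algebra is $E(\underline M)=M\otimes M'$ with product $(m\otimes m')(n\otimes n')=\mu(m'\otimes n)\,m\otimes n'$ and diagonal $G$-action. A $G$-module algebra is *elementary* if it is isomorphic, as a $G$-module algebra, to some $E(\underline M)$. Unital $G$-module algebras $A$ and $B$ are *Morita equivalent as $G$-module algebras* if there are an $A$-$B$-bimodule $P$ and a $B$-$A$-bimodule $Q$, unital on both sides and with $k$-linear $G$-actions satisfying $g(xy)=(gx)(gy)$ for the left and right module actions, and $G$-equivariant bimodule isomorphisms $f:P\otimes_B Q\to A$ and $h:Q\otimes_A P\to B$ with $f(p\otimes q)p'=p\,h(q\otimes p')$ and $h(q\otimes p)q'=q\,f(p\otimes q')$ for all $p,p'\in P$, $q,q'\in Q$. *Statement.* Let $A$ and $B$ be $G$-module Taylor–Azumaya algebras over $k$. The following assertions are equivalent: 1. $A$ and $B$ are Morita equivalent as $G$-module algebras; 2. $A\otimes B^{\rm op}$ is an elementary $G$-module algebra; 3. there exist dual pairs of $G$-modules $\underline M$ and $\underline N$ such that $A\otimes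 E(\underline M)\cong B\otimes E(\underline N)$ as $G$-module algebras. -/

import Mathlib

open scoped TensorProduct

universe u v

set_option linter.unusedSectionVars false

namespace EquivariantBrauer

/-! ### Modules over algebras without unit

A `k`-algebra `A`, not necessarily with unit, is given by
`[NonUnitalRing A] [Module k A] [IsScalarTower k A A] [SMulCommClass k A A]`.
A left `A`-module is a `k`-module `M` with a `k`-algebra map `ρ : A →ₙₐ[k] Module.End k M`, where
`a` acts on `m` as `ρ a m`; a right `A`-module is the same with `Aᵐᵒᵖ` in place of `A`. -/

section Modules

variable {k A : Type*} [CommRing k]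
  [NonUnitalRing A] [Module k A] [IsScalarTower k A A] [SMulCommClass k A A]
  {P Q M : Type*} [AddCommGroup P] [Module k P] [AddCommGroup Q] [Module k Q]
  [AddCommGroup M] [Module k M]

variable (k A) in
/-- `A` as a right module over itself. -/
def rightRegular : Aᵐᵒᵖ →ₙₐ[k] Module.End k A where
  toFun b := LinearMap.mulRight k b.unop
  map_smul' c b := by ext x; simp [mul_smul_comm]
  map_zero' := by ext x; simp
  map_add' b c := by ext x; simp [mul_add]
  map_mul' b c := by ext x; simp [mul_assoc]

/-- The relations `p a ⊗ q = p ⊗ a q` in `P ⊗ Q`. -/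
def balancedRelations (σ : Aᵐᵒᵖ →ₙₐ[k] Module.End k P) (ρ : A →ₙₐ[k] Module.End k Q) :
    Submodule k (P ⊗[k] Q) :=
  Submodule.span k
    {x | ∃ (a : A) (p : P) (q : Q), x = σ (MulOpposite.op a) p ⊗ₜ[k] q - p ⊗ₜ[k] ρ a q}

/-- The tensor product `P ⊗_A Q` of a right `A`-module `P` and a left `A`-module `Q`. -/
abbrev BalancedTensor (σ : Aᵐᵒᵖ →ₙₐ[k] Module.End k P) (ρ : A →ₙₐ[k] Module.End k Q) : Type _ :=
  (P ⊗[k] Q) ⧸ balancedRelations σ ρ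

/-- The class of `p ⊗ q` in `P ⊗_A Q`. -/
def btmul (σ : Aᵐᵒᵖ →ₙₐ[k] Module.End k P) (ρ : A →ₙₐ[k] Module.End k Q) (p : P) (q : Q) :
    BalancedTensor σ ρ :=
  (balancedRelations σ ρ).mkQ (p ⊗ₜ[k] q)

/-- The linear map out of `P ⊗_A Q` induced by a balanced bilinear map. -/
def balancedLift {R : Type*} [AddCommGroup R] [Module k R]
    (σ : Aᵐᵒᵖ →ₙₐ[k] Module.End k P) (ρ : A →ₙₐ[k] Module.End k Q) (f : P →ₗ[k] Q →ₗ[k] R)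
    (hf : ∀ (a : A) (p : P) (q : Q), f (σ (MulOpposite.op a) p) q = f p (ρ a q)) :
    BalancedTensor σ ρ →ₗ[k] R :=
  have h : balancedRelations σ ρ ≤ LinearMap.ker (TensorProduct.lift f) := by
    unfold balancedRelations
    refine Submodule.span_le.2 ?_
    rintro _ ⟨a, p, q, rfl⟩
    simp [hf]
  (balancedRelations σ ρ).liftQ (TensorProduct.lift f) h

theorem balancedLift_btmul {R : Type*} [AddCommGroup R] [Module k R]
    (σ : Aᵐᵒᵖ →ₙₐ[k] Module.End k P) (ρ : A →ₙₐ[k] Module.End k Q) (f : P →ₗ[k] Q →ₗ[k] R)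
    (hf : ∀ (a : A) (p : P) (q : Q), f (σ (MulOpposite.op a) p) q = f p (ρ a q)) (p : P) (q : Q) :
    balancedLift σ ρ f hf (btmul σ ρ p q) = f p q := rfl

/-- The canonical map `A ⊗_A M → M`, `a ⊗ m ↦ a m`. -/
def leftCanonical (ρ : A →ₙₐ[k] Module.End k M) :
    BalancedTensor (rightRegular k A) ρ →ₗ[k] M :=
  balancedLift (rightRegular k A) ρ (ρ : A →ₗ[k] Module.End k M) (by
    intro a b m
    simp [rightRegular])

theorem leftCanonical_btmul (ρ : A →ₙₐ[k] Module.End k M) (a : A) (m : M) :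
    leftCanonical ρ (btmul (rightRegular k A) ρ a m) = ρ a m := rfl

/-- The canonical map `M ⊗_A A → M`, `m ⊗ a ↦ m a`. -/
def rightCanonical (σ : Aᵐᵒᵖ →ₙₐ[k] Module.End k M) :
    BalancedTensor σ (NonUnitalAlgHom.lmul k A) →ₗ[k] M :=
  balancedLift σ (NonUnitalAlgHom.lmul k A)
    ((σ : Aᵐᵒᵖ →ₗ[k] Module.End k M) ∘ₗ
      (MulOpposite.opLinearEquiv k : A ≃ₗ[k] Aᵐᵒᵖ).toLinearMap).flip (by
    intro a m b
    simp)

theorem rightCanonical_btmul (σ : Aᵐᵒᵖ →ₙₐ[k] Module.End k M) (m : M) (a : A) :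
    rightCanonical σ (btmul σ (NonUnitalAlgHom.lmul k A) m a) = σ (MulOpposite.op a) m := rfl

/-- The left module `M` is unital: `A ⊗_A M → M` is an isomorphism. -/
def IsUnitalLeft (ρ : A →ₙₐ[k] Module.End k M) : Prop :=
  Function.Bijective (leftCanonical ρ)

/-- The right module `M` is unital: `M ⊗_A A → M` is an isomorphism. -/
def IsUnitalRight (σ : Aᵐᵒᵖ →ₙₐ[k] Module.End k M) : Prop :=
  Function.Bijective (rightCanonical σ)

variable (k A) in
/-- The algebra `A` is unital: `A ⊗_A A → A` is an isomorphism. -/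
def IsUnitalAlgebra : Prop :=
  IsUnitalLeft (NonUnitalAlgHom.lmul k A)

/-- The `k`-module `Hom_A(P, Q)` of left `A`-linear maps. -/
def homModule (ρ : A →ₙₐ[k] Module.End k P) (τ : A →ₙₐ[k] Module.End k Q) :
    Submodule k (P →ₗ[k] Q) where
  carrier := {f | ∀ (a : A) (p : P), f (ρ a p) = τ a (f p)}
  add_mem' hf hg a p := by simp [hf a p, hg a p]
  zero_mem' a p := by simp
  smul_mem' c f hf a p := by simp [hf a p]

/-- The left `A`-module `P ⊗ N`, for a left `A`-module `P` and a `k`-module `N`. -/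
noncomputable def tensorAction (ρ : A →ₙₐ[k] Module.End k P) (N : Type*) [AddCommGroup N]
    [Module k N] : A →ₙₐ[k] Module.End k (P ⊗[k] N) where
  toFun a := (ρ a).rTensor N
  map_smul' c a := by simp [LinearMap.rTensor_smul]
  map_zero' := by simp
  map_add' a b := by simp [LinearMap.rTensor_add]
  map_mul' a b := by simp [LinearMap.rTensor_mul]

theorem tensorAction_tmul (ρ : A →ₙₐ[k] Module.End k P) (N : Type*) [AddCommGroup N]
    [Module k N] (a : A) (p : P) (n : N) :
    tensorAction ρ N a (p ⊗ₜ[k] n) = ρ a p ⊗ₜ[k] n := rfl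

/-- The unit `N → Hom_A(P, P ⊗ N)`, `n ↦ (p ↦ p ⊗ n)`, of the adjunction between `P ⊗ -` and
`Hom_A(P, -)`. -/
noncomputable def adjUnit (ρ : A →ₙₐ[k] Module.End k P) (N : Type*) [AddCommGroup N]
    [Module k N] : N →ₗ[k] homModule ρ (tensorAction ρ N) :=
  LinearMap.codRestrict _ (TensorProduct.mk k P N).flip (by
    intro n a p
    simp [tensorAction])

theorem adjUnit_apply (ρ : A →ₙₐ[k] Module.End k P) (N : Type*) [AddCommGroup N]
    [Module k N] (n : N) (p : P) : (adjUnit ρ N n : P →ₗ[k] P ⊗[k] N) p = p ⊗ₜ[k] n := rfl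

/-- The counit `P ⊗ Hom_A(P, M) → M`, `p ⊗ f ↦ f p`, of the adjunction between `P ⊗ -` and
`Hom_A(P, -)`. -/
noncomputable def adjCounit (ρ : A →ₙₐ[k] Module.End k P) (τ : A →ₙₐ[k] Module.End k M) :
    P ⊗[k] homModule ρ τ →ₗ[k] M :=
  TensorProduct.lift (homModule ρ τ).subtype.flip

theorem adjCounit_tmul (ρ : A →ₙₐ[k] Module.End k P) (τ : A →ₙₐ[k] Module.End k M)
    (p : P) (f : homModule ρ τ) : adjCounit ρ τ (p ⊗ₜ[k] f) = (f : P →ₗ[k] M) p := rfl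

end Modules

/-! ### Taylor–Azumaya algebras -/

section TaylorAzumaya

variable (k A : Type u) [CommRing k]
  [NonUnitalRing A] [Module k A] [IsScalarTower k A A] [SMulCommClass k A A]

/-- `A` as a left module over the enveloping algebra `Aᵉ = A ⊗ Aᵒᵖ`: `(a ⊗ b) x = a x b`. -/
noncomputable def envAction : A ⊗[k] Aᵐᵒᵖ →ₙₐ[k] Module.End k A :=
  let f : A ⊗[k] Aᵐᵒᵖ →ₗ[k] Module.End k A :=
    TensorProduct.lift (LinearMap.mk₂ k
      (fun (a : A) (b : Aᵐᵒᵖ) => LinearMap.mulLeft k a ∘ₗ LinearMap.mulRight k b.unop)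
      (fun a a' b => by ext x; simp [add_mul])
      (fun c a b => by ext x; simp [smul_mul_assoc])
      (fun a b b' => by ext x; simp [mul_add])
      (fun c a b => by ext x; simp [mul_smul_comm]))
  { f with
    map_zero' := map_zero f
    map_mul' := fun x y => by
      change f (x * y) = f x * f y
      induction x with
      | zero => simp
      | add x x' hx hx' => simp [add_mul, hx, hx']
      | tmul a b =>
        induction y with
        | zero => simp
        | add y y' hy hy' => simp [mul_add, hy, hy']
        | tmul a' b' => ext x; simp [f, mul_assoc] }

theorem envAction_tmul (a : A) (b : Aᵐᵒᵖ) (x : A) :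
    envAction k A (a ⊗ₜ[k] b) x = a * (x * b.unop) := rfl

/-- `A` is a Taylor–Azumaya algebra: `A` is unital and faithful over `k`, and the adjoint functors
`F N = A ⊗ N`, from `k`-modules to unital left `Aᵉ`-modules, and `H M = Hom_{Aᵉ}(A, M)` are inverse
equivalences, that is, the unit and the counit of the adjunction are isomorphisms. -/
structure IsTaylorAzumaya : Prop where
  unital : IsUnitalAlgebra k A
  faithful : FaithfulSMul k A
  unit_bijective : ∀ (N : Type u) [AddCommGroup N] [Module k N],
    Function.Bijective (adjUnit (envAction k A) N)
  counit_bijective : ∀ (M : Type u) [AddCommGroup M] [Module k M]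
    (τ : A ⊗[k] Aᵐᵒᵖ →ₙₐ[k] Module.End k M), IsUnitalLeft τ →
    Function.Bijective (adjCounit (envAction k A) τ)

end TaylorAzumaya

/-! ### `G`-module algebras -/

/-- An action of the group `G` on the `k`-algebra `A` by `k`-algebra automorphisms: this makes `A`
a `G`-module algebra. -/
structure AlgAction (k G A : Type*) [CommRing k] [Group G] [NonUnitalRing A] [Module k A] where
  rep : Representation k G A
  map_mul : ∀ (g : G) (a b : A), rep g (a * b) = rep g a * rep g b

section AlgAction

variable {k G : Type*} [CommRing k] [Group G] {A B : Type*}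
  [NonUnitalRing A] [Module k A]
  [NonUnitalRing B] [Module k B]

/-- The diagonal action on `A ⊗ B`. -/
noncomputable def AlgAction.tensor [IsScalarTower k A A] [SMulCommClass k A A]
    [IsScalarTower k B B] [SMulCommClass k B B]
    (α : AlgAction k G A) (β : AlgAction k G B) : AlgAction k G (A ⊗[k] B) where
  rep := α.rep.tprod β.rep
  map_mul g x y := by
    induction x with
    | zero => simp
    | add x x' hx hx' => simp only [add_mul, map_add, hx, hx']
    | tmul a b =>
      induction y with
      | zero => simp
      | add y y' hy hy' => simp only [mul_add, map_add, hy, hy']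
      | tmul a' b' => simp [α.map_mul, β.map_mul]

/-- The opposite algebra, with the same action. -/
def AlgAction.op (α : AlgAction k G A) : AlgAction k G Aᵐᵒᵖ where
  rep :=
    { toFun := fun g => (MulOpposite.opLinearEquiv k).toLinearMap ∘ₗ α.rep g ∘ₗ
        (MulOpposite.opLinearEquiv k).symm.toLinearMap
      map_one' := by ext x; simp
      map_mul' := fun g h => by ext x; simp }
  map_mul g a b := by simp [α.map_mul]

/-- An isomorphism of `G`-module algebras. -/
structure AlgAction.Iso (α : AlgAction k G A) (β : AlgAction k G B) where
  toEquiv : A ≃ₗ[k] B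
  map_mul : ∀ a b : A, toEquiv (a * b) = toEquiv a * toEquiv b
  equivariant : ∀ (g : G) (a : A), toEquiv (α.rep g a) = β.rep g (toEquiv a)

end AlgAction

/-! ### Elementary algebras -/

/-- A dual pair of `k`-modules `(M, M', μ)`, with `μ : M' ⊗ M → k` surjective. -/
structure DualPair (k : Type u) [CommRing k] where
  M : Type u
  M' : Type u
  [addCommGroupM : AddCommGroup M]
  [moduleM : Module k M]
  [addCommGroupM' : AddCommGroup M']
  [moduleM' : Module k M']
  μ : M' ⊗[k] M →ₗ[k] k
  surjective : Function.Surjective μ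

attribute [instance] DualPair.addCommGroupM DualPair.moduleM
  DualPair.addCommGroupM' DualPair.moduleM'

section Elementary

variable {k : Type u} [CommRing k]

/-- The `k`-module `M ⊗ M'` underlying the elementary algebra of the dual pair `(M, M', μ)`. -/
def Elem (p : DualPair k) : Type u := p.M ⊗[k] p.M'

noncomputable instance (p : DualPair k) : AddCommGroup (Elem p) :=
  inferInstanceAs (AddCommGroup (p.M ⊗[k] p.M'))

noncomputable instance (p : DualPair k) : Module k (Elem p) :=
  inferInstanceAs (Module k (p.M ⊗[k] p.M'))

/-- The element `m ⊗ m'` of the elementary algebra. -/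
def Elem.tmul (p : DualPair k) (m : p.M) (m' : p.M') : Elem p := m ⊗ₜ[k] m'

/-- The action of `M ⊗ M'` on `M`: `(m ⊗ m') n = μ(m' ⊗ n) m`. -/
noncomputable def Elem.act (p : DualPair k) : p.M ⊗[k] p.M' →ₗ[k] Module.End k p.M :=
  TensorProduct.lift (LinearMap.mk₂ k
    (fun m m' => LinearMap.toSpanSingleton k p.M m ∘ₗ p.μ ∘ₗ TensorProduct.mk k p.M' p.M m')
    (fun m n m' => by ext x; simp)
    (fun c m m' => by ext x; simp [smul_comm c])
    (fun m m' n' => by ext x; simp [add_smul])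
    (fun c m m' => by ext x; simp [mul_smul]))

/-- The multiplication of the elementary algebra, as a bilinear map:
`(m ⊗ m') (n ⊗ n') = ((m ⊗ m') n) ⊗ n'`. -/
noncomputable def Elem.mulBilin (p : DualPair k) :
    p.M ⊗[k] p.M' →ₗ[k] p.M ⊗[k] p.M' →ₗ[k] p.M ⊗[k] p.M' :=
  LinearMap.rTensorHom p.M' ∘ₗ Elem.act p

noncomputable instance (p : DualPair k) : Mul (Elem p) where
  mul x y := Elem.mulBilin p x y

theorem Elem.mul_def (p : DualPair k) (x y : Elem p) : x * y = Elem.mulBilin p x y := rfl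

/-- The defining formula `(m ⊗ m') (n ⊗ n') = μ(m' ⊗ n) m ⊗ n'`. -/
theorem Elem.tmul_mul_tmul (p : DualPair k) (m n : p.M) (m' n' : p.M') :
    Elem.tmul p m m' * Elem.tmul p n n' = p.μ (m' ⊗ₜ[k] n) • Elem.tmul p m n' := by
  change (p.μ (m' ⊗ₜ[k] n) • m) ⊗ₜ[k] n' = p.μ (m' ⊗ₜ[k] n) • (m ⊗ₜ[k] n')
  rw [TensorProduct.smul_tmul']

theorem Elem.act_mul (p : DualPair k) (x y : p.M ⊗[k] p.M') :
    Elem.act p (Elem.mulBilin p x y) = Elem.act p x * Elem.act p y := by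
  induction y with
  | zero => simp
  | add y y' hy hy' => simp only [map_add, mul_add, hy, hy']
  | tmul n n' => ext l; simp [Elem.mulBilin, Elem.act]

/-- The elementary algebra `E(M)` of a dual pair. -/
noncomputable instance (p : DualPair k) : NonUnitalRing (Elem p) where
  left_distrib x y z := map_add (Elem.mulBilin p x) y z
  right_distrib x y z := LinearMap.map_add₂ (Elem.mulBilin p) x y z
  zero_mul x := LinearMap.map_zero₂ (Elem.mulBilin p) x
  mul_zero x := map_zero (Elem.mulBilin p x)
  mul_assoc x y z := by
    change (Elem.act p (Elem.mulBilin p x y)).rTensor p.M' z =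
      (Elem.act p x).rTensor p.M' ((Elem.act p y).rTensor p.M' z)
    exact (congrArg (fun e : Module.End k p.M => e.rTensor p.M' z) (Elem.act_mul p x y)).trans
      (LinearMap.rTensor_comp_apply p.M' (Elem.act p x) (Elem.act p y) z)

instance (p : DualPair k) : IsScalarTower k (Elem p) (Elem p) where
  smul_assoc c x y := LinearMap.map_smul₂ (Elem.mulBilin p) c x y

instance (p : DualPair k) : SMulCommClass k (Elem p) (Elem p) where
  smul_comm c x y := (map_smul (Elem.mulBilin p x) c y).symm

end Elementary

/-- A dual pair of `G`-modules: `M` and `M'` are `G`-modules and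
`μ(g m' ⊗ g m) = μ(m' ⊗ m)`. -/
structure GDualPair (k : Type u) [CommRing k] (G : Type v) [Group G] extends DualPair k where
  rep : Representation k G M
  rep' : Representation k G M'
  invariant : ∀ (g : G) (m' : M') (m : M), μ (rep' g m' ⊗ₜ[k] rep g m) = μ (m' ⊗ₜ[k] m)

section GElementary

variable {k : Type u} [CommRing k] {G : Type v} [Group G]

/-- The diagonal action of `G` on `M ⊗ M'`. -/
noncomputable def GDualPair.elemRep (p : GDualPair k G) : Representation k G (Elem p.toDualPair) :=
  (p.rep.tprod p.rep' : Representation k G (p.M ⊗[k] p.M'))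

/-- The elementary `G`-module algebra `E(M)` of a dual pair of `G`-modules. -/
noncomputable def GDualPair.algAction (p : GDualPair k G) : AlgAction k G (Elem p.toDualPair) where
  rep := p.elemRep
  map_mul g x y := by
    change TensorProduct.map (p.rep g) (p.rep' g) (Elem.mulBilin p.toDualPair x y) =
      Elem.mulBilin p.toDualPair (TensorProduct.map (p.rep g) (p.rep' g) x)
        (TensorProduct.map (p.rep g) (p.rep' g) y)
    change p.M ⊗[k] p.M' at x y
    induction x with
    | zero => simp
    | add x x' hx hx' => simp only [map_add, LinearMap.add_apply, hx, hx']
    | tmul a b =>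
      induction y with
      | zero => simp
      | add y y' hy hy' => simp only [map_add, hy, hy']
      | tmul a' b' => simp [Elem.mulBilin, Elem.act, p.invariant]

/-- A `G`-module algebra is elementary if it is isomorphic, as a `G`-module algebra, to `E(M)` for
some dual pair `M` of `G`-modules. -/
def IsElementary {A : Type*} [NonUnitalRing A] [Module k A] (α : AlgAction k G A) : Prop :=
  ∃ p : GDualPair k G, Nonempty (α.Iso p.algAction)

end GElementary

/-! ### Equivariant Morita equivalence -/

section Morita

variable {k : Type u} [CommRing k] {G : Type v} [Group G]

/-- An `A`-`B`-bimodule, unital on both sides, with a compatible action of `G`. -/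
structure GBimodule {A B : Type u}
    [NonUnitalRing A] [Module k A] [IsScalarTower k A A] [SMulCommClass k A A]
    [NonUnitalRing B] [Module k B] [IsScalarTower k B B] [SMulCommClass k B B]
    (α : AlgAction k G A) (β : AlgAction k G B) where
  carrier : Type u
  [addCommGroup : AddCommGroup carrier]
  [module : Module k carrier]
  left : A →ₙₐ[k] Module.End k carrier
  right : Bᵐᵒᵖ →ₙₐ[k] Module.End k carrier
  comm : ∀ (a : A) (b : Bᵐᵒᵖ) (p : carrier), left a (right b p) = right b (left a p)
  unital_left : IsUnitalLeft left
  unital_right : IsUnitalRight right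
  rep : Representation k G carrier
  rep_left : ∀ (g : G) (a : A) (p : carrier), rep g (left a p) = left (α.rep g a) (rep g p)
  rep_right : ∀ (g : G) (b : B) (p : carrier),
    rep g (right (MulOpposite.op b) p) = right (MulOpposite.op (β.rep g b)) (rep g p)

attribute [instance] GBimodule.addCommGroup GBimodule.module

/-- A strict `G`-equivariant Morita context connecting `A` and `B`: bimodules `P = {}_A P_B` and
`Q = {}_B Q_A`, and `G`-equivariant bimodule isomorphisms `f : P ⊗_B Q → A` and
`h : Q ⊗_A P → B`, such that `f(p ⊗ q) p' = p h(q ⊗ p')` and `h(q ⊗ p) q' = q f(p ⊗ q')`. -/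
structure StrictGMoritaContext {A B : Type u}
    [NonUnitalRing A] [Module k A] [IsScalarTower k A A] [SMulCommClass k A A]
    [NonUnitalRing B] [Module k B] [IsScalarTower k B B] [SMulCommClass k B B]
    (α : AlgAction k G A) (β : AlgAction k G B) where
  P : GBimodule α β
  Q : GBimodule β α
  f : BalancedTensor P.right Q.left →ₗ[k] A
  h : BalancedTensor Q.right P.left →ₗ[k] B
  f_left : ∀ (a : A) (p : P.carrier) (q : Q.carrier),
    f (btmul P.right Q.left (P.left a p) q) = a * f (btmul P.right Q.left p q)
  f_right : ∀ (a : A) (p : P.carrier) (q : Q.carrier),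
    f (btmul P.right Q.left p (Q.right (MulOpposite.op a) q)) = f (btmul P.right Q.left p q) * a
  h_left : ∀ (b : B) (q : Q.carrier) (p : P.carrier),
    h (btmul Q.right P.left (Q.left b q) p) = b * h (btmul Q.right P.left q p)
  h_right : ∀ (b : B) (q : Q.carrier) (p : P.carrier),
    h (btmul Q.right P.left q (P.right (MulOpposite.op b) p)) = h (btmul Q.right P.left q p) * b
  f_equivariant : ∀ (g : G) (p : P.carrier) (q : Q.carrier),
    f (btmul P.right Q.left (P.rep g p) (Q.rep g q)) = α.rep g (f (btmul P.right Q.left p q))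
  h_equivariant : ∀ (g : G) (q : Q.carrier) (p : P.carrier),
    h (btmul Q.right P.left (Q.rep g q) (P.rep g p)) = β.rep g (h (btmul Q.right P.left q p))
  assoc_P : ∀ (p : P.carrier) (q : Q.carrier) (p' : P.carrier),
    P.left (f (btmul P.right Q.left p q)) p' =
      P.right (MulOpposite.op (h (btmul Q.right P.left q p'))) p
  assoc_Q : ∀ (q : Q.carrier) (p : P.carrier) (q' : Q.carrier),
    Q.left (h (btmul Q.right P.left q p)) q' =
      Q.right (MulOpposite.op (f (btmul P.right Q.left p q'))) q
  f_bijective : Function.Bijective f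
  h_bijective : Function.Bijective h

end Morita

end EquivariantBrauer

/-! Without units, a module M over A is handled through firmness: M is spanned by the products am,
and every bilinear φ on A × M with φ(ab, m) = φ(a, bm) factors through am. Identities for which one
would otherwise insert 1 are checked on spanning values such as products or f(p, q).

1 ⇒ 2. Given a Morita context (P, Q, f, h), let Aᵉ act on A ⊗ Q by a(x ⊗ q)b = ax ⊗ qb and put N =
Hom_{Aᵉ}(A, A ⊗ Q). The counit is an isomorphism A ⊗ N ≅ A ⊗ Q; applying - ⊗_A P turns it into φ : P
⊗ N ≅ A ⊗ (Q ⊗_A P) ≅ A ⊗ B (`exists_dualEquiv`), linear over A ⊗ Bᵒᵖ. A bimodule endomorphism of P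
induces an Aᵉ-endomorphism of A ≅ P ⊗_B Q, hence is a scalar (`exists_scalar`). In particular x ↦
φ(x ⊗ η)p is multiplication by a scalar μ(η ⊗ p), and φ becomes an algebra isomorphism from E(P, N,
μ) (`isElementary_of_linearEquiv`). The construction is natural, so it respects G, which acts on N
by conjugation.

2 ⇒ 3. The identity context of B shows that B ⊗ Bᵒᵖ is some E(N). If A ⊗ Bᵒᵖ ≅ E(M), then A ⊗ E(N) ≅
A ⊗ B ⊗ Bᵒᵖ ≅ B ⊗ (A ⊗ Bᵒᵖ) ≅ B ⊗ E(M).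

3 ⇒ 1. The bimodules A ⊗ M' and A ⊗ M connect A with A ⊗ E(M) (`elemContext`), and contexts compose,
so A and B are connected through A ⊗ E(M) ≅ B ⊗ E(N). A `PreContext` only asks that the pairings
span and that AP = P, BQ = Q, so unitality of the middle algebra never enters. Over unital A and B
the pairings are automatically injective (`fLift_injective`), and left unitality of P and Q forces
right unitality (`isFirm_right`). -/

namespace EquivariantBrauer

/-! ### Firm modules -/

section Generates

variable {k : Type*} [CommRing k] {X Y Z W : Type*} [AddCommGroup X] [Module k X]
  [AddCommGroup Y] [Module k Y] [AddCommGroup Z] [Module k Z] [AddCommGroup W] [Module k W]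

/-- The values of the bilinear map `β` span its codomain. -/
def Generates (β : X →ₗ[k] Y →ₗ[k] Z) : Prop :=
  ∀ S : Submodule k Z, (∀ x y, β x y ∈ S) → ∀ z, z ∈ S

theorem Generates.ext {β : X →ₗ[k] Y →ₗ[k] Z} (hβ : Generates β) {f g : Z →ₗ[k] W}
    (h : ∀ x y, f (β x y) = g (β x y)) : f = g :=
  LinearMap.ext (hβ (LinearMap.eqLocus f g) h)

theorem Generates.surjective {β : X →ₗ[k] Y →ₗ[k] Z} (hβ : Generates β) {f : W →ₗ[k] Z}
    (h : ∀ x y, ∃ w, f w = β x y) : Function.Surjective f :=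
  hβ (LinearMap.range f) h

theorem generates_mk : Generates (TensorProduct.mk k X Y) := fun S hS z => by
  induction z with
  | zero => exact S.zero_mem
  | add x y hx hy => exact S.add_mem hx hy
  | tmul x y => exact hS x y

end Generates

section Balanced

variable {k A : Type*} [CommRing k]
  [NonUnitalRing A] [Module k A] [IsScalarTower k A A] [SMulCommClass k A A]
  {P Q M R : Type*} [AddCommGroup P] [Module k P] [AddCommGroup Q] [Module k Q]
  [AddCommGroup M] [Module k M] [AddCommGroup R] [Module k R]
  (σ : Aᵐᵒᵖ →ₙₐ[k] Module.End k P) (ρ : A →ₙₐ[k] Module.End k Q)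

/-- `btmul` as a bilinear map. -/
def btmulBilin : P →ₗ[k] Q →ₗ[k] BalancedTensor σ ρ :=
  (TensorProduct.mk k P Q).compr₂ (balancedRelations σ ρ).mkQ

@[simp] theorem btmulBilin_apply (p : P) (q : Q) : btmulBilin σ ρ p q = btmul σ ρ p q := rfl

theorem generates_btmul : Generates (btmulBilin σ ρ) := fun S hS z => by
  obtain ⟨t, rfl⟩ := Submodule.mkQ_surjective _ z
  exact generates_mk (S.comap (balancedRelations σ ρ).mkQ) hS t

theorem btmul_balanced (a : A) (p : P) (q : Q) :
    btmul σ ρ (σ (MulOpposite.op a) p) q = btmul σ ρ p (ρ a q) := by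
  rw [← sub_eq_zero]
  change (balancedRelations σ ρ).mkQ _ - (balancedRelations σ ρ).mkQ _ = 0
  rw [← map_sub, Submodule.mkQ_apply, Submodule.Quotient.mk_eq_zero]
  exact Submodule.subset_span ⟨a, p, q, rfl⟩

/-- The endomorphism of `P ⊗_A Q` induced by endomorphisms of `P` and `Q` that are semilinear with
respect to the same self-map of `A`. -/
def balancedMap (t : A → A) (f : P →ₗ[k] P) (g : Q →ₗ[k] Q)
    (hf : ∀ a p, f (σ (MulOpposite.op a) p) = σ (MulOpposite.op (t a)) (f p))
    (hg : ∀ a q, g (ρ a q) = ρ (t a) (g q)) : BalancedTensor σ ρ →ₗ[k] BalancedTensor σ ρ :=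
  balancedLift σ ρ ((btmulBilin σ ρ).compl₁₂ f g) fun a p q => by
    simp [hf, hg, btmul_balanced]

end Balanced

section Firm

variable {k A : Type u} [CommRing k]
  [NonUnitalRing A] [Module k A] [IsScalarTower k A A] [SMulCommClass k A A]
  {M : Type u} [AddCommGroup M] [Module k M]

/-- The values `a m` span `M`. -/
def ActionGenerates (ρ : A →ₙₐ[k] Module.End k M) : Prop :=
  Generates (ρ : A →ₗ[k] Module.End k M)

/-- Unital modules in terms of the universal property of `A ⊗_A M`. -/
structure IsFirm (ρ : A →ₙₐ[k] Module.End k M) : Prop where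
  generates : ActionGenerates ρ
  exists_lift : ∀ {R : Type u} [AddCommGroup R] [Module k R] (φ : A →ₗ[k] M →ₗ[k] R),
    (∀ a b m, φ (a * b) m = φ a (ρ b m)) → ∃ s : M →ₗ[k] R, ∀ a m, s (ρ a m) = φ a m

/-- The universal property replaces the quotient A ⊗_A M in later constructions of maps out of M. It
also treats both sides alike, a right A-module being a left module over `Aᵐᵒᵖ`. -/
theorem IsUnitalLeft.isFirm {ρ : A →ₙₐ[k] Module.End k M} (h : IsUnitalLeft ρ) : IsFirm ρ where
  generates S hS z := by
    obtain ⟨t, rfl⟩ := h.2 z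
    exact generates_btmul _ _ (S.comap (leftCanonical ρ)) hS t
  exists_lift φ hφ := by
    let e := LinearEquiv.ofBijective (leftCanonical ρ) h
    refine ⟨balancedLift (rightRegular k A) ρ φ (fun a b m => hφ b a m) ∘ₗ e.symm.toLinearMap,
      fun a m => ?_⟩
    have : e.symm (ρ a m) = btmul _ _ a m := e.symm_apply_eq.2 rfl
    rw [LinearMap.comp_apply, LinearEquiv.coe_coe, this]
    rfl

theorem IsFirm.isUnitalLeft {ρ : A →ₙₐ[k] Module.End k M} (h : IsFirm ρ) : IsUnitalLeft ρ := by
  refine ⟨?_, h.generates.surjective fun a m => ⟨btmul _ _ a m, rfl⟩⟩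
  -- The universal property is applied to A ⊗_A M itself; the resulting map is a retraction of the
  -- canonical map.
  obtain ⟨s, hs⟩ := h.exists_lift (btmulBilin (rightRegular k A) ρ)
    (fun a b m => btmul_balanced (rightRegular k A) ρ b a m)
  exact Function.LeftInverse.injective (g := s) fun t =>
    LinearMap.congr_fun (f := s ∘ₗ leftCanonical ρ) (g := LinearMap.id)
      ((generates_btmul _ _).ext fun a m => hs a m) t

theorem IsUnitalRight.isFirm {σ : Aᵐᵒᵖ →ₙₐ[k] Module.End k M} (h : IsUnitalRight σ) :
    IsFirm σ where
  generates S hS z := by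
    obtain ⟨t, rfl⟩ := h.2 z
    exact generates_btmul _ _ (S.comap (rightCanonical σ)) (fun m a => hS (MulOpposite.op a) m) t
  exists_lift φ hφ := by
    let e := LinearEquiv.ofBijective (rightCanonical σ) h
    refine ⟨balancedLift σ (NonUnitalAlgHom.lmul k A)
      (φ ∘ₗ (MulOpposite.opLinearEquiv k : A ≃ₗ[k] Aᵐᵒᵖ).toLinearMap).flip
      (fun a m b => (hφ (MulOpposite.op b) (MulOpposite.op a) m).symm) ∘ₗ e.symm.toLinearMap,
      fun a m => ?_⟩
    have : e.symm (σ a m) = btmul _ _ m a.unop := e.symm_apply_eq.2 rfl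
    rw [LinearMap.comp_apply, LinearEquiv.coe_coe, this]
    rfl

theorem IsFirm.isUnitalRight {σ : Aᵐᵒᵖ →ₙₐ[k] Module.End k M} (h : IsFirm σ) :
    IsUnitalRight σ := by
  refine ⟨?_, h.generates.surjective fun a m => ⟨btmul _ _ m a.unop, rfl⟩⟩
  obtain ⟨s, hs⟩ := h.exists_lift ((btmulBilin σ (NonUnitalAlgHom.lmul k A)).flip ∘ₗ
      (MulOpposite.opLinearEquiv k : A ≃ₗ[k] Aᵐᵒᵖ).symm.toLinearMap)
    (fun a b m => (btmul_balanced σ (NonUnitalAlgHom.lmul k A) b.unop m a.unop).symm)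
  exact Function.LeftInverse.injective (g := s) fun t =>
    LinearMap.congr_fun (f := s ∘ₗ rightCanonical σ) (g := LinearMap.id)
      ((generates_btmul _ _).ext fun m a => hs (MulOpposite.op a) m) t

/-- A surjection onto a unital algebra from a module `X = A X` is injective as soon as `A`
annihilates its kernel. -/
theorem injective_of_kernel_annihilated (hA : IsFirm (NonUnitalAlgHom.lmul k A))
    {ρ : A →ₙₐ[k] Module.End k M} (hρ : ActionGenerates ρ) (f : M →ₗ[k] A)
    (hf : ∀ a m, f (ρ a m) = a * f m) (hsurj : Function.Surjective f)
    (hker : ∀ m, f m = 0 → ∀ a, ρ a m = 0) : Function.Injective f := by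
  have key : ∀ m n, f m = f n → ∀ a, ρ a m = ρ a n := fun m n h a => by
    rw [← sub_eq_zero, ← map_sub]
    exact hker _ (by simp [h]) a
  -- A set-theoretic section g suffices: a·g(b) does not depend on the chosen preimage of b, since A
  -- kills the kernel, so it is bilinear and balanced. The induced s(ab) = a·g(b) satisfies s(f(am))
  -- = s(a f(m)) = am.
  choose g hg using hsurj
  obtain ⟨s, hs⟩ := hA.exists_lift (R := M) (LinearMap.mk₂ k (fun a b => ρ a (g b))
    (fun a b c => by simp) (fun c a b => by simp)
    (fun a b c => by rw [← map_add]; exact key _ _ (by simp [hg]) a)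
    (fun c a b => by rw [← map_smul]; exact key _ _ (by simp [hg]) a))
    (fun a b c => by
      simp only [LinearMap.mk₂_apply, map_mul, Module.End.mul_apply]
      exact key _ _ (by simp [hf, hg]) a)
  refine Function.LeftInverse.injective (g := s) fun m =>
    LinearMap.congr_fun (f := s ∘ₗ f) (g := LinearMap.id) (hρ.ext fun a m => ?_) m
  change s (f (ρ a m)) = ρ a m
  rw [hf]
  exact (hs a (f m)).trans (key _ _ (hg _) a)

end Firm

/-! ### Actions of tensor products of algebras -/

section CommutingActions

variable {k A B : Type u} [CommRing k]
  [NonUnitalRing A] [Module k A] [IsScalarTower k A A] [SMulCommClass k A A]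
  [NonUnitalRing B] [Module k B] [IsScalarTower k B B] [SMulCommClass k B B]
  {M : Type u} [AddCommGroup M] [Module k M]

/-- The linear map `a ⊗ b ↦ u a ∘ v b`. -/
noncomputable def compTensor (u : A →ₗ[k] Module.End k M) (v : B →ₗ[k] Module.End k M) :
    A ⊗[k] B →ₗ[k] Module.End k M :=
  TensorProduct.lift ((LinearMap.mul k (Module.End k M)).compl₁₂ u v)

theorem compTensor_mul {u : A →ₗ[k] Module.End k M} {v : B →ₗ[k] Module.End k M}
    (hu : ∀ a b m, u (a * b) m = u a (u b m)) (hv : ∀ a b m, v (a * b) m = v a (v b m))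
    (hc : ∀ a b m, u a (v b m) = v b (u a m)) (x y : A ⊗[k] B) :
    compTensor u v (x * y) = compTensor u v x * compTensor u v y := by
  induction x with
  | zero => rw [zero_mul, map_zero, zero_mul]
  | add x x' hx hx' => rw [add_mul, map_add, map_add, add_mul, hx, hx']
  | tmul a b =>
    induction y with
    | zero => rw [mul_zero, map_zero, mul_zero]
    | add y y' hy hy' => rw [mul_add, map_add, map_add, mul_add, hy, hy']
    | tmul a' b' =>
      ext m
      rw [Algebra.TensorProduct.tmul_mul_tmul]
      change u (a * a') (v (b * b') m) = u a (v b (u a' (v b' m)))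
      rw [hu, hv, hc a' b]

/-- The action of `A ⊗ B` given by commuting actions of `A` and `B`. -/
noncomputable def commAction (ρ : A →ₙₐ[k] Module.End k M) (σ : B →ₙₐ[k] Module.End k M)
    (hc : ∀ a b m, ρ a (σ b m) = σ b (ρ a m)) : A ⊗[k] B →ₙₐ[k] Module.End k M where
  toFun := compTensor (ρ : A →ₗ[k] Module.End k M) (σ : B →ₗ[k] Module.End k M)
  map_smul' := map_smul _
  map_zero' := map_zero _
  map_add' := map_add _
  map_mul' := compTensor_mul
    (fun a b m => LinearMap.congr_fun (map_mul ρ a b) m)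
    (fun a b m => LinearMap.congr_fun (map_mul σ a b) m) hc

theorem commAction_generates {ρ : A →ₙₐ[k] Module.End k M} {σ : B →ₙₐ[k] Module.End k M}
    (hc : ∀ a b m, ρ a (σ b m) = σ b (ρ a m)) (hρ : ActionGenerates ρ) (hσ : ActionGenerates σ) :
    ActionGenerates (commAction ρ σ hc) := fun S hS =>
  hρ S fun a => hσ (S.comap (ρ a)) fun b m => hS (a ⊗ₜ[k] b) m

/-- A map balanced over A ⊗ B is balanced over A and over B separately, because A and B are spanned
by their products. It can then be factored through one action at a time. -/
theorem commAction_isFirm (hA : ActionGenerates (NonUnitalAlgHom.lmul k A))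
    (hB : ActionGenerates (NonUnitalAlgHom.lmul k B))
    {ρ : A →ₙₐ[k] Module.End k M} {σ : B →ₙₐ[k] Module.End k M}
    (hc : ∀ a b m, ρ a (σ b m) = σ b (ρ a m)) (hρ : IsFirm ρ) (hσ : IsFirm σ) :
    IsFirm (commAction ρ σ hc) where
  generates := commAction_generates hc hρ.generates hσ.generates
  exists_lift {R} _ _ φ hφ := by
    have hφ' : ∀ a b c d m, φ ((a * c) ⊗ₜ (b * d)) m = φ (a ⊗ₜ b) (ρ c (σ d m)) :=
      fun a b c d m => by
        rw [← Algebra.TensorProduct.tmul_mul_tmul, hφ]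
        rfl
    let ψ : A →ₗ[k] B →ₗ[k] M →ₗ[k] R := (TensorProduct.mk k A B).compr₂ φ
    -- On products aa' and bb', both sides equal the value of φ at a ⊗ b and the element (a'c)(b'm).
    have h₁ : ∀ c m a b, φ ((a * c) ⊗ₜ b) m = φ (a ⊗ₜ b) (ρ c m) := fun c m a b => by
      refine LinearMap.congr_fun₂ (f := (ψ ∘ₗ LinearMap.mulRight k c).compr₂ (LinearMap.applyₗ m))
        (g := ψ.compr₂ (LinearMap.applyₗ (ρ c m))) (hA.ext fun a a' => hB.ext fun b b' => ?_) a b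
      change φ ((a * a' * c) ⊗ₜ (b * b')) m = φ ((a * a') ⊗ₜ (b * b')) (ρ c m)
      rw [mul_assoc, hφ', hφ', ← hc, map_mul]
      rfl
    have h₂ : ∀ c m a b, φ (a ⊗ₜ (b * c)) m = φ (a ⊗ₜ b) (σ c m) := fun c m a b => by
      refine LinearMap.congr_fun₂
        (f := (ψ.compl₂ (LinearMap.mulRight k c)).compr₂ (LinearMap.applyₗ m))
        (g := ψ.compr₂ (LinearMap.applyₗ (σ c m))) (hA.ext fun a a' => hB.ext fun b b' => ?_) a b
      change φ ((a * a') ⊗ₜ (b * b' * c)) m = φ ((a * a') ⊗ₜ (b * b')) (σ c m)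
      rw [mul_assoc, hφ', hφ', map_mul]
      rfl
    -- First the A-variable is absorbed, with the B-variable kept as an argument of the target; the
    -- resulting map is then balanced over B, as is tested on the spanning elements am.
    let ψ' : A →ₗ[k] M →ₗ[k] B →ₗ[k] R :=
      (LinearMap.lflip (R₀ := k)).toLinearMap ∘ₗ ψ
    obtain ⟨s, hs⟩ := hρ.exists_lift ψ'
      (fun a c m => LinearMap.ext fun b => h₁ c m a b)
    have hs' : ∀ a m b, s (ρ a m) b = φ (a ⊗ₜ b) m := fun a m b =>
      LinearMap.congr_fun (hs a m) b
    obtain ⟨t, ht⟩ := hσ.exists_lift s.flip fun b c m => by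
      refine LinearMap.congr_fun (f := s.flip (b * c)) (g := s.flip b ∘ₗ σ c)
        (hρ.generates.ext fun a m => ?_) m
      change s (ρ a m) (b * c) = s (σ c (ρ a m)) b
      rw [← hc, hs', hs', h₂]
    refine ⟨t, fun x m => ?_⟩
    refine LinearMap.congr_fun (f := t ∘ₗ (commAction ρ σ hc : A ⊗[k] B →ₗ[k] Module.End k M).flip m)
      (g := φ.flip m) (TensorProduct.ext' fun a b => ?_) x
    change t (ρ a (σ b m)) = φ (a ⊗ₜ b) m
    rw [hc, ht]
    exact hs' a m b

end CommutingActions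

/-! ### Morita contexts whose bimodules need not be unital -/

section PreBimodule

variable {k : Type u} [CommRing k] {G : Type v} [Group G]

/-- An `A`-`B`-bimodule with a compatible action of `G`, not necessarily unital. -/
structure PreBimodule {A B : Type u}
    [NonUnitalRing A] [Module k A] [IsScalarTower k A A] [SMulCommClass k A A]
    [NonUnitalRing B] [Module k B] [IsScalarTower k B B] [SMulCommClass k B B]
    (α : AlgAction k G A) (β : AlgAction k G B) where
  carrier : Type u
  [addCommGroup : AddCommGroup carrier]
  [module : Module k carrier]
  left : A →ₙₐ[k] Module.End k carrier
  right : Bᵐᵒᵖ →ₙₐ[k] Module.End k carrier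
  comm : ∀ (a : A) (b : Bᵐᵒᵖ) (p : carrier), left a (right b p) = right b (left a p)
  rep : Representation k G carrier
  rep_left : ∀ (g : G) (a : A) (p : carrier), rep g (left a p) = left (α.rep g a) (rep g p)
  rep_right : ∀ (g : G) (b : B) (p : carrier),
    rep g (right (MulOpposite.op b) p) = right (MulOpposite.op (β.rep g b)) (rep g p)

attribute [instance] PreBimodule.addCommGroup PreBimodule.module

variable {A B C : Type u}
    [NonUnitalRing A] [Module k A] [IsScalarTower k A A] [SMulCommClass k A A]
    [NonUnitalRing B] [Module k B] [IsScalarTower k B B] [SMulCommClass k B B]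
    [NonUnitalRing C] [Module k C] [IsScalarTower k C C] [SMulCommClass k C C]
    {α : AlgAction k G A} {β : AlgAction k G B} {γ : AlgAction k G C}

/-- A bimodule that is unital on both sides, as a `GBimodule`. -/
def PreBimodule.toGBimodule (P : PreBimodule α β) (hl : IsFirm P.left) (hr : IsFirm P.right) :
    GBimodule α β :=
  { P with
    unital_left := hl.isUnitalLeft
    unital_right := hr.isUnitalRight }

/-- The bimodule `P ⊗_C Q`. -/
def PreBimodule.tensor (P : PreBimodule α γ) (Q : PreBimodule γ β) : PreBimodule α β where
  carrier := BalancedTensor P.right Q.left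
  left :=
    { toFun := fun a => balancedMap P.right Q.left id (P.left a) LinearMap.id
        (fun _ _ => P.comm _ _ _) (fun _ _ => rfl)
      map_smul' := fun c a => (generates_btmul _ _).ext fun p q => by
        change btmulBilin P.right Q.left (P.left (c • a) p) q =
          c • btmulBilin P.right Q.left (P.left a p) q
        simp only [map_smul, LinearMap.smul_apply]
      map_zero' := (generates_btmul _ _).ext fun p q => by
        change btmulBilin P.right Q.left (P.left 0 p) q = 0
        simp only [map_zero, LinearMap.zero_apply]
      map_add' := fun a b => (generates_btmul _ _).ext fun p q => by
        change btmulBilin P.right Q.left (P.left (a + b) p) q =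
          btmulBilin P.right Q.left (P.left a p) q + btmulBilin P.right Q.left (P.left b p) q
        simp only [map_add, LinearMap.add_apply]
      map_mul' := fun a b => (generates_btmul _ _).ext fun p q => by
        change btmulBilin P.right Q.left (P.left (a * b) p) q =
          btmulBilin P.right Q.left (P.left a (P.left b p)) q
        simp only [map_mul, Module.End.mul_apply] }
  right :=
    { toFun := fun b => balancedMap P.right Q.left id LinearMap.id (Q.right b)
        (fun _ _ => rfl) (fun _ _ => (Q.comm _ _ _).symm)
      map_smul' := fun c a => (generates_btmul _ _).ext fun p q => by
        change btmulBilin P.right Q.left p (Q.right (c • a) q) =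
          c • btmulBilin P.right Q.left p (Q.right a q)
        simp only [map_smul, LinearMap.smul_apply]
      map_zero' := (generates_btmul _ _).ext fun p q => by
        change btmulBilin P.right Q.left p (Q.right 0 q) = 0
        simp only [map_zero, LinearMap.zero_apply]
      map_add' := fun a b => (generates_btmul _ _).ext fun p q => by
        change btmulBilin P.right Q.left p (Q.right (a + b) q) =
          btmulBilin P.right Q.left p (Q.right a q) + btmulBilin P.right Q.left p (Q.right b q)
        simp only [map_add, LinearMap.add_apply]
      map_mul' := fun a b => (generates_btmul _ _).ext fun p q => by
        change btmulBilin P.right Q.left p (Q.right (a * b) q) =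
          btmulBilin P.right Q.left p (Q.right a (Q.right b q))
        simp only [map_mul, Module.End.mul_apply] }
  comm a b x := LinearMap.congr_fun
    (f := balancedMap P.right Q.left id (P.left a) LinearMap.id
        (fun _ _ => P.comm _ _ _) (fun _ _ => rfl) ∘ₗ
      balancedMap P.right Q.left id LinearMap.id (Q.right b)
        (fun _ _ => rfl) (fun _ _ => (Q.comm _ _ _).symm))
    (g := balancedMap P.right Q.left id LinearMap.id (Q.right b)
        (fun _ _ => rfl) (fun _ _ => (Q.comm _ _ _).symm) ∘ₗ
      balancedMap P.right Q.left id (P.left a) LinearMap.id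
        (fun _ _ => P.comm _ _ _) (fun _ _ => rfl))
    ((generates_btmul _ _).ext fun _ _ => rfl) x
  rep :=
    { toFun := fun g => balancedMap P.right Q.left (γ.rep g) (P.rep g) (Q.rep g)
        (P.rep_right g) (Q.rep_left g)
      map_one' := (generates_btmul _ _).ext fun p q => by
        change btmul P.right Q.left (P.rep 1 p) (Q.rep 1 q) = btmul P.right Q.left p q
        simp only [map_one, Module.End.one_apply]
      map_mul' := fun g h => (generates_btmul _ _).ext fun p q => by
        change btmul P.right Q.left (P.rep (g * h) p) (Q.rep (g * h) q) =
          btmul P.right Q.left (P.rep g (P.rep h p)) (Q.rep g (Q.rep h q))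
        simp only [map_mul, Module.End.mul_apply] }
  rep_left g a x := LinearMap.congr_fun
    (f := balancedMap P.right Q.left (γ.rep g) (P.rep g) (Q.rep g)
        (P.rep_right g) (Q.rep_left g) ∘ₗ
      balancedMap P.right Q.left id (P.left a) LinearMap.id
        (fun _ _ => P.comm _ _ _) (fun _ _ => rfl))
    (g := balancedMap P.right Q.left id (P.left (α.rep g a)) LinearMap.id
        (fun _ _ => P.comm _ _ _) (fun _ _ => rfl) ∘ₗ
      balancedMap P.right Q.left (γ.rep g) (P.rep g) (Q.rep g)
        (P.rep_right g) (Q.rep_left g))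
    ((generates_btmul _ _).ext fun p q => by
      change btmul P.right Q.left (P.rep g (P.left a p)) (Q.rep g q) =
        btmul P.right Q.left (P.left (α.rep g a) (P.rep g p)) (Q.rep g q)
      rw [P.rep_left]) x
  rep_right g b x := LinearMap.congr_fun
    (f := balancedMap P.right Q.left (γ.rep g) (P.rep g) (Q.rep g)
        (P.rep_right g) (Q.rep_left g) ∘ₗ
      balancedMap P.right Q.left id LinearMap.id (Q.right (MulOpposite.op b))
        (fun _ _ => rfl) (fun _ _ => (Q.comm _ _ _).symm))
    (g := balancedMap P.right Q.left id LinearMap.id (Q.right (MulOpposite.op (β.rep g b)))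
        (fun _ _ => rfl) (fun _ _ => (Q.comm _ _ _).symm) ∘ₗ
      balancedMap P.right Q.left (γ.rep g) (P.rep g) (Q.rep g)
        (P.rep_right g) (Q.rep_left g))
    ((generates_btmul _ _).ext fun p q => by
      change btmul P.right Q.left (P.rep g p) (Q.rep g (Q.right (MulOpposite.op b) q)) =
        btmul P.right Q.left (P.rep g p) (Q.right (MulOpposite.op (β.rep g b)) (Q.rep g q))
      rw [Q.rep_right]) x

theorem PreBimodule.tensor_generates (P : PreBimodule α γ) (Q : PreBimodule γ β)
    (hP : ActionGenerates P.left) : ActionGenerates (P.tensor Q).left := fun S hS =>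
  generates_btmul P.right Q.left S fun p q =>
    hP (S.comap ((btmulBilin P.right Q.left).flip q))
      (fun a p => hS a (btmul P.right Q.left p q)) p

/-- A ⊗_A (P ⊗_C Q) ≅ (A ⊗_A P) ⊗_C Q, so left unitality depends on the first factor only. -/
theorem PreBimodule.tensor_isFirm (P : PreBimodule α γ) (Q : PreBimodule γ β)
    (hP : IsFirm P.left) : IsFirm (P.tensor Q).left where
  generates := P.tensor_generates Q hP.generates
  exists_lift {R} _ _ φ hφ := by
    have hφ' : ∀ a b p q, φ (a * b) (btmul P.right Q.left p q) =
        φ a (btmul P.right Q.left (P.left b p) q) := fun a b p q => hφ a b (btmul _ _ p q)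
    let φ₀ : A →ₗ[k] BalancedTensor P.right Q.left →ₗ[k] R := φ
    let ψ : A →ₗ[k] P.carrier →ₗ[k] Q.carrier →ₗ[k] R :=
      LinearMap.mk₂ k (fun a p => φ₀ a ∘ₗ btmulBilin P.right Q.left p)
        (fun a b p => by ext q; simp) (fun c a p => by ext q; simp)
        (fun a p q => by ext r; simp) (fun c a p => by ext r; simp)
    obtain ⟨s, hs⟩ := hP.exists_lift ψ fun a b p => LinearMap.ext fun q => hφ' a b p q
    have hs' : ∀ a p q, s (P.left a p) q = φ a (btmul _ _ p q) := fun a p q =>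
      LinearMap.congr_fun (hs a p) q
    -- The right action of C commutes with the left action of A, so balance over C may be tested on
    -- elements ap, where s is given by φ.
    have hbal : ∀ c p q, s (P.right (MulOpposite.op c) p) q = s p (Q.left c q) := fun c p q => by
      refine LinearMap.congr_fun (f := s.flip q ∘ₗ P.right (MulOpposite.op c))
        (g := s.flip (Q.left c q)) (hP.generates.ext fun a p => ?_) p
      change s (P.right (MulOpposite.op c) (P.left a p)) q = s (P.left a p) (Q.left c q)
      rw [← P.comm, hs', hs', btmul_balanced]
    exact ⟨balancedLift P.right Q.left s hbal, fun a x => LinearMap.congr_fun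
      (f := balancedLift P.right Q.left s hbal ∘ₗ (P.tensor Q).left a)
      (g := φ a) ((generates_btmul _ _).ext fun p q => hs' a p q) x⟩

end PreBimodule

/-! ### Morita contexts: automatic injectivity, unitality and composition -/

section PreContext

variable {k : Type u} [CommRing k] {G : Type v} [Group G]

/-- Bimodules `P = {}_A P_B` and `Q = {}_B Q_A` with equivariant pairings to `A` and `B` whose values
span `A` and `B`, such that `A P = P` and `B Q = Q`. -/
structure PreContext {A B : Type u}
    [NonUnitalRing A] [Module k A] [IsScalarTower k A A] [SMulCommClass k A A]
    [NonUnitalRing B] [Module k B] [IsScalarTower k B B] [SMulCommClass k B B]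
    (α : AlgAction k G A) (β : AlgAction k G B) where
  P : PreBimodule α β
  Q : PreBimodule β α
  f : P.carrier →ₗ[k] Q.carrier →ₗ[k] A
  h : Q.carrier →ₗ[k] P.carrier →ₗ[k] B
  f_balanced : ∀ (b : B) (p : P.carrier) (q : Q.carrier),
    f (P.right (MulOpposite.op b) p) q = f p (Q.left b q)
  h_balanced : ∀ (a : A) (q : Q.carrier) (p : P.carrier),
    h (Q.right (MulOpposite.op a) q) p = h q (P.left a p)
  f_left : ∀ (a : A) (p : P.carrier) (q : Q.carrier), f (P.left a p) q = a * f p q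
  f_right : ∀ (a : A) (p : P.carrier) (q : Q.carrier),
    f p (Q.right (MulOpposite.op a) q) = f p q * a
  h_left : ∀ (b : B) (q : Q.carrier) (p : P.carrier), h (Q.left b q) p = b * h q p
  h_right : ∀ (b : B) (q : Q.carrier) (p : P.carrier),
    h q (P.right (MulOpposite.op b) p) = h q p * b
  f_equivariant : ∀ (g : G) (p : P.carrier) (q : Q.carrier),
    f (P.rep g p) (Q.rep g q) = α.rep g (f p q)
  h_equivariant : ∀ (g : G) (q : Q.carrier) (p : P.carrier),
    h (Q.rep g q) (P.rep g p) = β.rep g (h q p)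
  assoc_P : ∀ (p : P.carrier) (q : Q.carrier) (p' : P.carrier),
    P.left (f p q) p' = P.right (MulOpposite.op (h q p')) p
  assoc_Q : ∀ (q : Q.carrier) (p : P.carrier) (q' : Q.carrier),
    Q.left (h q p) q' = Q.right (MulOpposite.op (f p q')) q
  P_generates : ActionGenerates P.left
  Q_generates : ActionGenerates Q.left
  f_generates : Generates f
  h_generates : Generates h

variable {A B C : Type u}
    [NonUnitalRing A] [Module k A] [IsScalarTower k A A] [SMulCommClass k A A]
    [NonUnitalRing B] [Module k B] [IsScalarTower k B B] [SMulCommClass k B B]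
    [NonUnitalRing C] [Module k C] [IsScalarTower k C C] [SMulCommClass k C C]
    {α : AlgAction k G A} {β : AlgAction k G B} {γ : AlgAction k G C}

/-- The right action of `A` on `M` as a bilinear map. -/
def rightBilin {M : Type*} [AddCommGroup M] [Module k M]
    (σ : Aᵐᵒᵖ →ₙₐ[k] Module.End k M) : A →ₗ[k] M →ₗ[k] M :=
  (σ : Aᵐᵒᵖ →ₗ[k] Module.End k M) ∘ₗ (MulOpposite.opLinearEquiv k : A ≃ₗ[k] Aᵐᵒᵖ).toLinearMap

theorem balanced_ext {X Y M N R : Type*} [AddCommGroup X] [Module k X]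
    [AddCommGroup Y] [Module k Y] [AddCommGroup M] [Module k M] [AddCommGroup N] [Module k N]
    [AddCommGroup R] [Module k R]
    {σ : Aᵐᵒᵖ →ₙₐ[k] Module.End k X} {ρ : A →ₙₐ[k] Module.End k Y}
    {σ' : Bᵐᵒᵖ →ₙₐ[k] Module.End k M} {ρ' : B →ₙₐ[k] Module.End k N}
    {f g : BalancedTensor σ ρ →ₗ[k] BalancedTensor σ' ρ' →ₗ[k] R}
    (h : ∀ x y m n, f (btmul σ ρ x y) (btmul σ' ρ' m n) = g (btmul σ ρ x y) (btmul σ' ρ' m n)) :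
    f = g :=
  (generates_btmul _ _).ext fun x y => (generates_btmul _ _).ext fun m n => h x y m n

namespace PreContext

/-- The context with the roles of `A` and `B` exchanged. -/
def symm (c : PreContext α β) : PreContext β α where
  P := c.Q
  Q := c.P
  f := c.h
  h := c.f
  f_balanced := c.h_balanced
  h_balanced := c.f_balanced
  f_left := c.h_left
  f_right := c.h_right
  h_left := c.f_left
  h_right := c.f_right
  f_equivariant := c.h_equivariant
  h_equivariant := c.f_equivariant
  assoc_P := c.assoc_Q
  assoc_Q := c.assoc_P
  P_generates := c.Q_generates
  Q_generates := c.P_generates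
  f_generates := c.h_generates
  h_generates := c.f_generates

/-- P is spanned by the elements f(p', q)p, and f(p', q)p = p' h(q, p) lies in PB. -/
theorem P_generates_right (c : PreContext α β) : ActionGenerates c.P.right := fun S hS =>
  c.P_generates S fun a p =>
    c.f_generates (S.comap ((c.P.left : A →ₗ[k] Module.End k c.P.carrier).flip p))
      (fun p' q => by
        change c.P.left (c.f p' q) p ∈ S
        rw [c.assoc_P]
        exact hS _ _) a

/-- The map `P ⊗_B Q → A`. -/
def fLift (c : PreContext α β) : BalancedTensor c.P.right c.Q.left →ₗ[k] A :=
  balancedLift c.P.right c.Q.left c.f c.f_balanced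

theorem fLift_surjective (c : PreContext α β) : Function.Surjective c.fLift :=
  c.f_generates.surjective fun p q => ⟨btmul _ _ p q, rfl⟩

/-- The classical argument would write 1 as a sum of values of f. Here it only yields that A
annihilates the kernel, which is enough when A is unital and A(P ⊗_B Q) = P ⊗_B Q. -/
theorem fLift_injective (c : PreContext α β) (hA : IsFirm (NonUnitalAlgHom.lmul k A)) :
    Function.Injective c.fLift := by
  refine injective_of_kernel_annihilated hA (ρ := (c.P.tensor c.Q).left)
    (c.P.tensor_generates c.Q c.P_generates) c.fLift (fun a x => ?_) c.fLift_surjective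
    fun x hx => ?_
  · exact LinearMap.congr_fun (f := c.fLift ∘ₗ (c.P.tensor c.Q).left a)
      (g := LinearMap.mulLeft k a ∘ₗ c.fLift)
      ((generates_btmul _ _).ext fun p q => c.f_left a p q) x
  -- On x = p' ⊗ q': f(p, q)p' ⊗ q' = p h(q, p') ⊗ q' = p ⊗ h(q, p')q' = p ⊗ q f(p', q'). So f(p,
  -- q)x depends only on the image of x in A.
  · have key : ∀ p q, (c.P.tensor c.Q).left (c.f p q) x =
        (c.P.tensor c.Q).right (MulOpposite.op (c.fLift x)) (btmul c.P.right c.Q.left p q) :=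
      fun p q => by
        refine LinearMap.congr_fun (f := (c.P.tensor c.Q).left (c.f p q))
          (g := ((c.P.tensor c.Q).right : Aᵐᵒᵖ →ₗ[k] Module.End k _).flip (btmul c.P.right c.Q.left p q) ∘ₗ
            (MulOpposite.opLinearEquiv k : A ≃ₗ[k] Aᵐᵒᵖ).toLinearMap ∘ₗ c.fLift)
          ((generates_btmul _ _).ext fun p' q' => ?_) x
        change btmul c.P.right c.Q.left (c.P.left (c.f p q) p') q' =
          btmul c.P.right c.Q.left p (c.Q.right (MulOpposite.op (c.f p' q')) q)
        rw [c.assoc_P, btmul_balanced, c.assoc_Q]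
    refine c.f_generates (LinearMap.ker (((c.P.tensor c.Q).left : A →ₗ[k] Module.End k _).flip x))
      fun p q => ?_
    change (c.P.tensor c.Q).left (c.f p q) x = 0
    refine (key p q).trans ((congrArg (fun z => (c.P.tensor c.Q).right (MulOpposite.op z)
      (btmul c.P.right c.Q.left p q)) hx).trans ?_)
    simp only [MulOpposite.op_zero, map_zero]
    rfl

/-- Since A ≅ P ⊗_B Q, a map balanced over B on pairs (p, b) gives one balanced over A on pairs
(f(p, q), p') by taking b = h(q, p'). The two universal properties match because f(p, q)p' = p h(q,
p'). -/
theorem isFirm_right (c : PreContext α β) (hA : IsFirm (NonUnitalAlgHom.lmul k A))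
    (hP : IsFirm c.P.left) : IsFirm c.P.right where
  generates := c.P_generates_right
  exists_lift {R} _ _ φ hφ := by
    let e := LinearEquiv.ofBijective c.fLift ⟨c.fLift_injective hA, c.fLift_surjective⟩
    let o : B →ₗ[k] Bᵐᵒᵖ := (MulOpposite.opLinearEquiv k : B ≃ₗ[k] Bᵐᵒᵖ).toLinearMap
    -- t(p, q, p') is the value that the sought map must take at p h(q, p') = f(p, q)p'.
    let t : c.P.carrier →ₗ[k] c.Q.carrier →ₗ[k] c.P.carrier →ₗ[k] R :=
      LinearMap.mk₂ k (fun p q => (φ.flip p ∘ₗ o) ∘ₗ c.h q)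
        (fun p p' q => by ext; simp) (fun r p q => by ext; simp)
        (fun p q q' => by ext; simp) (fun r p q => by ext; simp)
    have ht : ∀ p q p', t p q p' = φ (MulOpposite.op (c.h q p')) p := fun _ _ _ => rfl
    have hb : ∀ b p q, t (c.P.right (MulOpposite.op b) p) q = t p (c.Q.left b q) :=
      fun b p q => LinearMap.ext fun p' => by rw [ht, ht, ← hφ, c.h_left]; rfl
    let ψ : A →ₗ[k] c.P.carrier →ₗ[k] R :=
      balancedLift c.P.right c.Q.left t hb ∘ₗ e.symm.toLinearMap
    have hψ : ∀ p q p', ψ (c.f p q) p' = φ (MulOpposite.op (c.h q p')) p := fun p q p' => by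
      have : e.symm (c.f p q) = btmul _ _ p q := e.symm_apply_eq.2 rfl
      change balancedLift c.P.right c.Q.left t hb (e.symm (c.f p q)) p' = _
      rw [this]
      rfl
    obtain ⟨s, hs⟩ := hP.exists_lift ψ fun a b p' => by
      refine LinearMap.congr_fun (f := ψ.flip p' ∘ₗ LinearMap.mulRight k b)
        (g := ψ.flip (c.P.left b p')) (c.f_generates.ext fun p q => ?_) a
      change ψ (c.f p q * b) p' = ψ (c.f p q) (c.P.left b p')
      rw [← c.f_right, hψ, hψ, c.h_balanced]
    refine ⟨s, fun b p => ?_⟩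
    refine LinearMap.congr_fun (f := s ∘ₗ (c.P.right : Bᵐᵒᵖ →ₗ[k] Module.End k _).flip p ∘ₗ o)
      (g := φ.flip p ∘ₗ o) (c.h_generates.ext fun q p' => ?_) b.unop
    change s (c.P.right (MulOpposite.op (c.h q p')) p) = φ (MulOpposite.op (c.h q p')) p
    rw [← c.assoc_P, hs, hψ]

/-- Over unital algebras, a context whose bimodules are unital on the left is a strict Morita
context. -/
def toStrict (c : PreContext α β) (hA : IsFirm (NonUnitalAlgHom.lmul k A))
    (hB : IsFirm (NonUnitalAlgHom.lmul k B)) (hP : IsFirm c.P.left) (hQ : IsFirm c.Q.left) :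
    StrictGMoritaContext α β where
  P := c.P.toGBimodule hP (c.isFirm_right hA hP)
  Q := c.Q.toGBimodule hQ (c.symm.isFirm_right hB hQ)
  f := c.fLift
  h := c.symm.fLift
  f_left := c.f_left
  f_right := c.f_right
  h_left := c.h_left
  h_right := c.h_right
  f_equivariant := c.f_equivariant
  h_equivariant := c.h_equivariant
  assoc_P := c.assoc_P
  assoc_Q := c.assoc_Q
  f_bijective := ⟨c.fLift_injective hA, c.fLift_surjective⟩
  h_bijective := ⟨c.symm.fLift_injective hB, c.symm.fLift_surjective⟩

/-- The map `q₂ ⊗ q₁ ↦ f₁ (p₁ f₂(p₂, q₂), q₁)`. -/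
def transPairingAux (c : PreContext α γ) (d : PreContext γ β) (p₁ : c.P.carrier)
    (p₂ : d.P.carrier) : BalancedTensor d.Q.right c.Q.left →ₗ[k] A :=
  balancedLift d.Q.right c.Q.left (c.f ∘ₗ (rightBilin c.P.right).flip p₁ ∘ₗ d.f p₂)
    fun x q₂ q₁ => by
      change c.f (c.P.right (MulOpposite.op (d.f p₂ (d.Q.right (MulOpposite.op x) q₂))) p₁) q₁ =
        c.f (c.P.right (MulOpposite.op (d.f p₂ q₂)) p₁) (c.Q.left x q₁)
      rw [d.f_right, ← c.f_balanced, MulOpposite.op_mul, map_mul]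
      rfl

theorem transPairingAux_btmul (c : PreContext α γ) (d : PreContext γ β) (p₁ : c.P.carrier)
    (p₂ : d.P.carrier) (q₂ : d.Q.carrier) (q₁ : c.Q.carrier) :
    transPairingAux c d p₁ p₂ (btmul d.Q.right c.Q.left q₂ q₁) =
      c.f (c.P.right (MulOpposite.op (d.f p₂ q₂)) p₁) q₁ := rfl

/-- The pairing `(p₁ ⊗ p₂, q₂ ⊗ q₁) ↦ f₁ (p₁ f₂(p₂, q₂), q₁)`. -/
def transPairing (c : PreContext α γ) (d : PreContext γ β) :
    BalancedTensor c.P.right d.P.left →ₗ[k] BalancedTensor d.Q.right c.Q.left →ₗ[k] A :=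
  balancedLift c.P.right d.P.left (LinearMap.mk₂ k (transPairingAux c d)
    (fun p p' p₂ => (generates_btmul _ _).ext fun q₂ q₁ => by
      simp [transPairingAux_btmul])
    (fun r p p₂ => (generates_btmul _ _).ext fun q₂ q₁ => by
      simp [transPairingAux_btmul])
    (fun p p₂ p₂' => (generates_btmul _ _).ext fun q₂ q₁ => by
      simp [transPairingAux_btmul])
    (fun r p p₂ => (generates_btmul _ _).ext fun q₂ q₁ => by
      simp [transPairingAux_btmul]))
    fun x p₁ p₂ => (generates_btmul _ _).ext fun q₂ q₁ => by
      simp [transPairingAux_btmul, d.f_left]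

/-- A is spanned by f₁(P, Q), P by the products with C on the right, and C by f₂. -/
theorem transPairing_generates (c : PreContext α γ) (d : PreContext γ β) :
    Generates (transPairing c d) := fun S hS =>
  c.f_generates S fun p₁ q₁ =>
    c.P_generates_right (S.comap (c.f.flip q₁)) (fun x p => by
      refine d.f_generates (S.comap (c.f.flip q₁ ∘ₗ (rightBilin c.P.right).flip p))
        (fun p₂ q₂ => ?_) x.unop
      exact hS (btmul _ _ p p₂) (btmul _ _ q₂ q₁)) p₁

/-- The composite of two contexts. -/
def trans (c : PreContext α γ) (d : PreContext γ β) : PreContext α β where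
  P := c.P.tensor d.P
  Q := d.Q.tensor c.Q
  f := transPairing c d
  h := transPairing d.symm c.symm
  f_balanced b x y := LinearMap.congr_fun₂
    (f := transPairing c d ∘ₗ (c.P.tensor d.P).right (MulOpposite.op b))
    (g := (transPairing c d).compl₂ ((d.Q.tensor c.Q).left b))
    (balanced_ext fun p₁ p₂ q₂ q₁ => by
      change c.f (c.P.right (MulOpposite.op (d.f (d.P.right (MulOpposite.op b) p₂) q₂)) p₁) q₁ =
        c.f (c.P.right (MulOpposite.op (d.f p₂ (d.Q.left b q₂))) p₁) q₁
      rw [d.f_balanced]) x y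
  h_balanced a y x := LinearMap.congr_fun₂
    (f := transPairing d.symm c.symm ∘ₗ (d.Q.tensor c.Q).right (MulOpposite.op a))
    (g := (transPairing d.symm c.symm).compl₂ ((c.P.tensor d.P).left a))
    (balanced_ext fun (q₂ : d.Q.carrier) (q₁ : c.Q.carrier) (p₁ : c.P.carrier) (p₂ : d.P.carrier) => by
      change d.h (d.Q.right (MulOpposite.op (c.h (c.Q.right (MulOpposite.op a) q₁) p₁)) q₂) p₂ =
        d.h (d.Q.right (MulOpposite.op (c.h q₁ (c.P.left a p₁))) q₂) p₂
      rw [c.h_balanced]) y x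
  f_left a x y := LinearMap.congr_fun₂
    (f := transPairing c d ∘ₗ (c.P.tensor d.P).left a)
    (g := (transPairing c d).compr₂ (LinearMap.mulLeft k a))
    (balanced_ext fun p₁ p₂ q₂ q₁ => by
      change c.f (c.P.right (MulOpposite.op (d.f p₂ q₂)) (c.P.left a p₁)) q₁ =
        a * c.f (c.P.right (MulOpposite.op (d.f p₂ q₂)) p₁) q₁
      rw [← c.P.comm, c.f_left]) x y
  f_right a x y := LinearMap.congr_fun₂
    (f := (transPairing c d).compl₂ ((d.Q.tensor c.Q).right (MulOpposite.op a)))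
    (g := (transPairing c d).compr₂ (LinearMap.mulRight k a))
    (balanced_ext fun p₁ p₂ q₂ q₁ => c.f_right _ _ _) x y
  h_left b y x := LinearMap.congr_fun₂
    (f := transPairing d.symm c.symm ∘ₗ (d.Q.tensor c.Q).left b)
    (g := (transPairing d.symm c.symm).compr₂ (LinearMap.mulLeft k b))
    (balanced_ext fun (q₂ : d.Q.carrier) (q₁ : c.Q.carrier) (p₁ : c.P.carrier) (p₂ : d.P.carrier) => by
      change d.h (d.Q.right (MulOpposite.op (c.h q₁ p₁)) (d.Q.left b q₂)) p₂ =
        b * d.h (d.Q.right (MulOpposite.op (c.h q₁ p₁)) q₂) p₂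
      rw [← d.Q.comm, d.h_left]) y x
  h_right b y x := LinearMap.congr_fun₂
    (f := (transPairing d.symm c.symm).compl₂ ((c.P.tensor d.P).right (MulOpposite.op b)))
    (g := (transPairing d.symm c.symm).compr₂ (LinearMap.mulRight k b))
    (balanced_ext fun (q₂ : d.Q.carrier) (q₁ : c.Q.carrier) (p₁ : c.P.carrier) (p₂ : d.P.carrier) => d.h_right _ _ _) y x
  f_equivariant g x y := LinearMap.congr_fun₂
    (f := (transPairing c d).compl₁₂ ((c.P.tensor d.P).rep g) ((d.Q.tensor c.Q).rep g))
    (g := (transPairing c d).compr₂ (α.rep g))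
    (balanced_ext fun p₁ p₂ q₂ q₁ => by
      change c.f (c.P.right (MulOpposite.op (d.f (d.P.rep g p₂) (d.Q.rep g q₂))) (c.P.rep g p₁))
        (c.Q.rep g q₁) = α.rep g (c.f (c.P.right (MulOpposite.op (d.f p₂ q₂)) p₁) q₁)
      rw [d.f_equivariant, ← c.P.rep_right, c.f_equivariant]) x y
  h_equivariant g y x := LinearMap.congr_fun₂
    (f := (transPairing d.symm c.symm).compl₁₂ ((d.Q.tensor c.Q).rep g) ((c.P.tensor d.P).rep g))
    (g := (transPairing d.symm c.symm).compr₂ (β.rep g))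
    (balanced_ext fun (q₂ : d.Q.carrier) (q₁ : c.Q.carrier) (p₁ : c.P.carrier) (p₂ : d.P.carrier) => by
      change d.h (d.Q.right (MulOpposite.op (c.h (c.Q.rep g q₁) (c.P.rep g p₁))) (d.Q.rep g q₂))
        (d.P.rep g p₂) = β.rep g (d.h (d.Q.right (MulOpposite.op (c.h q₁ p₁)) q₂) p₂)
      rw [c.h_equivariant, ← d.Q.rep_right, d.h_equivariant]) y x
  assoc_P x y x' := by
    refine LinearMap.congr_fun (g := (rightBilin (c.P.tensor d.P).right).flip x ∘ₗ
      transPairing d.symm c.symm y) ((generates_btmul _ _).ext fun (p₁' : c.P.carrier) (p₂' : d.P.carrier) => ?_) x'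
    refine LinearMap.congr_fun₂
      (f := (transPairing c d).compr₂ (((c.P.tensor d.P).left : A →ₗ[k] Module.End k (c.P.tensor d.P).carrier).flip
        (btmul c.P.right d.P.left p₁' p₂')))
      (g := ((rightBilin (c.P.tensor d.P).right) ∘ₗ
        (transPairing d.symm c.symm).flip (btmul c.P.right d.P.left p₁' p₂')).flip)
      (balanced_ext fun p₁ p₂ q₂ q₁ => ?_) x y
    change btmul c.P.right d.P.left
        (c.P.left (c.f (c.P.right (MulOpposite.op (d.f p₂ q₂)) p₁) q₁) p₁') p₂' =
      btmul c.P.right d.P.left p₁ (d.P.right (MulOpposite.op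
        (d.h (d.Q.right (MulOpposite.op (c.h q₁ p₁')) q₂) p₂')) p₂)
    -- Both sides become p₁ ⊗ f₂(p₂, q₂)(h₁(q₁, p₁')p₂').
    rw [c.assoc_P, btmul_balanced, btmul_balanced, d.h_balanced, d.assoc_P]
  assoc_Q y x y' := by
    refine LinearMap.congr_fun (g := (rightBilin (d.Q.tensor c.Q).right).flip y ∘ₗ
      transPairing c d x) ((generates_btmul _ _).ext fun q₂' q₁' => ?_) y'
    refine LinearMap.congr_fun₂
      (f := (transPairing d.symm c.symm).compr₂
        (((d.Q.tensor c.Q).left : B →ₗ[k] Module.End k (d.Q.tensor c.Q).carrier).flip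
          (btmul d.Q.right c.Q.left q₂' q₁')))
      (g := ((rightBilin (d.Q.tensor c.Q).right) ∘ₗ
        (transPairing c d).flip (btmul d.Q.right c.Q.left q₂' q₁')).flip)
      (balanced_ext fun (q₂ : d.Q.carrier) (q₁ : c.Q.carrier) (p₁ : c.P.carrier) (p₂ : d.P.carrier) => ?_) y x
    change btmul d.Q.right c.Q.left
        (d.Q.left (d.h (d.Q.right (MulOpposite.op (c.h q₁ p₁)) q₂) p₂) q₂') q₁' =
      btmul d.Q.right c.Q.left q₂ (c.Q.right (MulOpposite.op
        (c.f (c.P.right (MulOpposite.op (d.f p₂ q₂')) p₁) q₁')) q₁)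
    rw [d.assoc_Q, btmul_balanced, btmul_balanced, c.f_balanced, c.assoc_Q]
  P_generates := c.P.tensor_generates d.P c.P_generates
  Q_generates := d.Q.tensor_generates c.Q d.Q_generates
  f_generates := transPairing_generates c d
  h_generates := transPairing_generates d.symm c.symm

end PreContext

end PreContext

/-! ### The context between `A` and `A ⊗ E(M)` -/

section Elementary

variable {k : Type u} [CommRing k]

/-- `Elem.tmul` as a bilinear map. -/
noncomputable def Elem.tmulBilin (p : DualPair k) : p.M →ₗ[k] p.M' →ₗ[k] Elem p :=
  TensorProduct.mk k p.M p.M'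

theorem Elem.generates (p : DualPair k) : Generates (Elem.tmulBilin p) :=
  generates_mk

/-- The right action of `M ⊗ M'` on `M'`: `n' (m ⊗ m') = μ(n' ⊗ m) m'`. -/
noncomputable def Elem.coact (p : DualPair k) : Elem p →ₗ[k] Module.End k p.M' :=
  TensorProduct.lift (LinearMap.mk₂ k
    (fun m m' => LinearMap.toSpanSingleton k p.M' m' ∘ₗ p.μ ∘ₗ (TensorProduct.mk k p.M' p.M).flip m)
    (fun m n m' => by ext x; simp [add_smul])
    (fun c m m' => by ext x; simp [mul_smul])
    (fun m m' n' => by ext x; simp)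
    (fun c m m' => by ext x; simp [smul_comm c]))

/-- The left action of `M ⊗ M'` on `M`. -/
noncomputable def Elem.action (p : DualPair k) : Elem p →ₗ[k] Module.End k p.M := Elem.act p

theorem Elem.coact_tmul (p : DualPair k) (m : p.M) (m' n' : p.M') :
    Elem.coact p (Elem.tmul p m m') n' = p.μ (n' ⊗ₜ m) • m' := rfl

theorem Elem.action_tmul (p : DualPair k) (m n : p.M) (m' : p.M') :
    Elem.action p (Elem.tmul p m m') n = p.μ (m' ⊗ₜ n) • m := rfl

theorem Elem.action_mul (p : DualPair k) (x y : Elem p) (n : p.M) :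
    Elem.action p (x * y) n = Elem.action p x (Elem.action p y n) :=
  LinearMap.congr_fun (Elem.act_mul p x y) n

theorem Elem.coact_mul (p : DualPair k) (x y : Elem p) (n' : p.M') :
    Elem.coact p (x * y) n' = Elem.coact p y (Elem.coact p x n') := by
  refine LinearMap.congr_fun₂ (f := (LinearMap.mul k (Elem p)).compr₂
      ((Elem.coact p).flip n'))
    (g := ((Elem.coact p).flip ∘ₗ (Elem.coact p).flip n'))
    ((Elem.generates p).ext fun a a' => (Elem.generates p).ext fun b b' => ?_) x y
  change Elem.coact p (Elem.tmul p a a' * Elem.tmul p b b') n' =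
    Elem.coact p (Elem.tmul p b b') (Elem.coact p (Elem.tmul p a a') n')
  rw [Elem.tmul_mul_tmul]
  simp only [map_smul, LinearMap.smul_apply, Elem.coact_tmul, smul_smul]
  rw [mul_comm]

end Elementary

/-! ### The bimodules A ⊗ M' and A ⊗ M -/

section ElementaryContext

variable {k : Type u} [CommRing k] {G : Type v} [Group G]

theorem GDualPair.act_equivariant (p : GDualPair k G) (g : G) (x : Elem p.toDualPair) (n : p.M) :
    p.rep g (Elem.action p.toDualPair x n) =
      Elem.action p.toDualPair (p.algAction.rep g x) (p.rep g n) := by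
  refine LinearMap.congr_fun (f := p.rep g ∘ₗ (Elem.action p.toDualPair).flip n)
    (g := (Elem.action p.toDualPair).flip (p.rep g n) ∘ₗ p.algAction.rep g)
    ((Elem.generates p.toDualPair).ext fun m m' => ?_) x
  change p.rep g (p.μ (m' ⊗ₜ n) • m) = p.μ (p.rep' g m' ⊗ₜ p.rep g n) • p.rep g m
  rw [map_smul, p.invariant]

theorem GDualPair.coact_equivariant (p : GDualPair k G) (g : G) (x : Elem p.toDualPair)
    (n' : p.M') : p.rep' g (Elem.coact p.toDualPair x n') =
      Elem.coact p.toDualPair (p.algAction.rep g x) (p.rep' g n') := by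
  refine LinearMap.congr_fun (f := p.rep' g ∘ₗ (Elem.coact p.toDualPair).flip n')
    (g := (Elem.coact p.toDualPair).flip (p.rep' g n') ∘ₗ p.algAction.rep g)
    ((Elem.generates p.toDualPair).ext fun m m' => ?_) x
  change p.rep' g (p.μ (n' ⊗ₜ m) • m') = p.μ (p.rep' g n' ⊗ₜ p.rep g m) • p.rep' g m'
  rw [map_smul, p.invariant]

variable {A C : Type u}
    [NonUnitalRing A] [Module k A] [IsScalarTower k A A] [SMulCommClass k A A]
    [NonUnitalRing C] [Module k C] [IsScalarTower k C C] [SMulCommClass k C C]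
    {α : AlgAction k G A} {γ : AlgAction k G C}

/-- A linear map to endomorphisms that reverses products, as a right action. -/
def rightAction {M : Type u} [AddCommGroup M] [Module k M] (u : C →ₗ[k] Module.End k M)
    (hu : ∀ x y, u (x * y) = u y * u x) : Cᵐᵒᵖ →ₙₐ[k] Module.End k M where
  toFun x := u x.unop
  map_smul' c x := by simp
  map_zero' := by simp
  map_add' x y := by simp
  map_mul' x y := by simp [hu]

theorem compTensor_mul_rev {B M : Type u} [NonUnitalRing B] [Module k B] [IsScalarTower k B B]
    [SMulCommClass k B B] [AddCommGroup M] [Module k M]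
    {u : A →ₗ[k] Module.End k M} {v : B →ₗ[k] Module.End k M}
    (hu : ∀ a b m, u (a * b) m = u b (u a m)) (hv : ∀ a b m, v (a * b) m = v b (v a m))
    (hc : ∀ a b m, u a (v b m) = v b (u a m)) (x y : A ⊗[k] B) :
    compTensor u v (x * y) = compTensor u v y * compTensor u v x := by
  induction x with
  | zero => rw [zero_mul, map_zero, mul_zero]
  | add x x' hx hx' => rw [add_mul, map_add, map_add, mul_add, hx, hx']
  | tmul a b =>
    induction y with
    | zero => rw [mul_zero, map_zero, zero_mul]
    | add y y' hy hy' => rw [mul_add, map_add, map_add, add_mul, hy, hy']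
    | tmul a' b' =>
      ext m
      rw [Algebra.TensorProduct.tmul_mul_tmul]
      change u (a * a') (v (b * b') m) = u a' (v b' (u a (v b m)))
      rw [hu, hv, hc a b']

/-- Right multiplications on `A ⊗ N`. -/
noncomputable def mulRightTensor (A N : Type u) [NonUnitalRing A] [Module k A]
    [IsScalarTower k A A] [SMulCommClass k A A] [AddCommGroup N] [Module k N] :
    A →ₗ[k] Module.End k (A ⊗[k] N) :=
  LinearMap.rTensorHom N ∘ₗ (LinearMap.mul k A).flip

variable (p : GDualPair k G) (e : γ.Iso (α.tensor p.algAction))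

/-- `A ⊗ E(M)` acts on `A ⊗ M` from the left. -/
noncomputable def elemLeft (A : Type u) [NonUnitalRing A] [Module k A]
    [IsScalarTower k A A] [SMulCommClass k A A] (p : DualPair k) :
    A ⊗[k] Elem p →ₗ[k] Module.End k (A ⊗[k] p.M) :=
  compTensor (tensorAction (NonUnitalAlgHom.lmul k A) p.M : A →ₗ[k] Module.End k (A ⊗[k] p.M))
    (LinearMap.lTensorHom A ∘ₗ Elem.action p)

/-- `A ⊗ E(M)` acts on `A ⊗ M'` from the right. -/
noncomputable def elemRight (A : Type u) [NonUnitalRing A] [Module k A]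
    [IsScalarTower k A A] [SMulCommClass k A A] (p : DualPair k) :
    A ⊗[k] Elem p →ₗ[k] Module.End k (A ⊗[k] p.M') :=
  compTensor (mulRightTensor A p.M') (LinearMap.lTensorHom A ∘ₗ Elem.coact p)

theorem elemLeft_tmul (p : DualPair k) (a b : A) (x : Elem p) (m : p.M) :
    elemLeft A p (a ⊗ₜ x) (b ⊗ₜ m) = (a * b) ⊗ₜ Elem.action p x m := rfl

theorem elemLeft_mul (p : DualPair k) (x y : A ⊗[k] Elem p) :
    elemLeft A p (x * y) = elemLeft A p x * elemLeft A p y := by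
  refine compTensor_mul (fun a b m => ?_) (fun a b m => ?_) (fun a b m => ?_) x y
  · induction m with
    | zero => simp only [map_zero]
    | add x y hx hy => simp only [map_add, hx, hy]
    | tmul c n => exact congrArg (· ⊗ₜ[k] n) (mul_assoc a b c)
  · induction m with
    | zero => simp only [map_zero]
    | add x y hx hy => simp only [map_add, hx, hy]
    | tmul c n => exact congrArg (c ⊗ₜ[k] ·) (Elem.action_mul p a b n)
  · induction m with
    | zero => simp only [map_zero]
    | add x y hx hy => simp only [map_add, hx, hy]
    | tmul c n => rfl

theorem elemRight_mul (p : DualPair k) (x y : A ⊗[k] Elem p) :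
    elemRight A p (x * y) = elemRight A p y * elemRight A p x := by
  refine compTensor_mul_rev (fun a b m => ?_) (fun a b m => ?_) (fun a b m => ?_) x y
  · induction m with
    | zero => simp only [map_zero]
    | add x y hx hy => simp only [map_add, hx, hy]
    | tmul c n => exact congrArg (· ⊗ₜ[k] n) (mul_assoc c a b).symm
  · induction m with
    | zero => simp only [map_zero]
    | add x y hx hy => simp only [map_add, hx, hy]
    | tmul c n => exact congrArg (c ⊗ₜ[k] ·) (Elem.coact_mul p a b n)
  · induction m with
    | zero => simp only [map_zero]
    | add x y hx hy => simp only [map_add, hx, hy]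
    | tmul c n => rfl

theorem generates_tmul_elem (A : Type u) [NonUnitalRing A] [Module k A] (p : DualPair k)
    {W : Type u} [AddCommGroup W] [Module k W] {f g : A ⊗[k] Elem p →ₗ[k] W}
    (h : ∀ a m m', f (a ⊗ₜ Elem.tmul p m m') = g (a ⊗ₜ Elem.tmul p m m')) : f = g :=
  TensorProduct.ext (LinearMap.ext fun a => (Elem.generates p).ext fun m m' => h a m m')

theorem elemLeft_equivariant (g : G) (x : A ⊗[k] Elem p.toDualPair) (y : A ⊗[k] p.M) :
    (α.rep.tprod p.rep) g (elemLeft A p.toDualPair x y) =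
      elemLeft A p.toDualPair ((α.tensor p.algAction).rep g x) ((α.rep.tprod p.rep) g y) := by
  induction y with
  | zero => simp only [map_zero]
  | add y y' hy hy' => simp only [map_add, hy, hy']
  | tmul b n =>
    induction x with
    | zero => simp only [map_zero, LinearMap.zero_apply]
    | add x x' hx hx' => simp only [map_add, LinearMap.add_apply, hx, hx']
    | tmul a x =>
      change α.rep g (a * b) ⊗ₜ[k] p.rep g (Elem.action p.toDualPair x n) =
        (α.rep g a * α.rep g b) ⊗ₜ[k]
          Elem.action p.toDualPair (p.algAction.rep g x) (p.rep g n)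
      rw [α.map_mul, p.act_equivariant]

theorem elemRight_equivariant (g : G) (x : A ⊗[k] Elem p.toDualPair) (y : A ⊗[k] p.M') :
    (α.rep.tprod p.rep') g (elemRight A p.toDualPair x y) =
      elemRight A p.toDualPair ((α.tensor p.algAction).rep g x) ((α.rep.tprod p.rep') g y) := by
  induction y with
  | zero => simp only [map_zero]
  | add y y' hy hy' => simp only [map_add, hy, hy']
  | tmul b n =>
    induction x with
    | zero => simp only [map_zero, LinearMap.zero_apply]
    | add x x' hx hx' => simp only [map_add, LinearMap.add_apply, hx, hx']
    | tmul a x =>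
      change α.rep g (b * a) ⊗ₜ[k] p.rep' g (Elem.coact p.toDualPair x n) =
        (α.rep g b * α.rep g a) ⊗ₜ[k]
          Elem.coact p.toDualPair (p.algAction.rep g x) (p.rep' g n)
      rw [α.map_mul, p.coact_equivariant]

/-- The bimodule `A ⊗ M'`. -/
noncomputable def elemP : PreBimodule α γ where
  carrier := A ⊗[k] p.M'
  left := tensorAction (NonUnitalAlgHom.lmul k A) p.M'
  right := rightAction (elemRight A p.toDualPair ∘ₗ e.toEquiv.toLinearMap) fun x y => by
    simp only [LinearMap.comp_apply, LinearEquiv.coe_coe, e.map_mul, elemRight_mul]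
  comm a x y := by
    change tensorAction (NonUnitalAlgHom.lmul k A) p.M' a
        (elemRight A p.toDualPair (e.toEquiv x.unop) y) =
      elemRight A p.toDualPair (e.toEquiv x.unop) (tensorAction (NonUnitalAlgHom.lmul k A) p.M' a y)
    induction e.toEquiv x.unop with
    | zero => simp only [map_zero, LinearMap.zero_apply]
    | add x x' hx hx' => simp only [map_add, LinearMap.add_apply, hx, hx']
    | tmul b x =>
      induction y with
      | zero => simp only [map_zero]
      | add y y' hy hy' => simp only [map_add, hy, hy']
      | tmul c n => exact congrArg (· ⊗ₜ[k] Elem.coact p.toDualPair x n) (mul_assoc a c b).symm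
  rep := α.rep.tprod p.rep'
  rep_left g a y := by
    induction y with
    | zero => simp only [map_zero]
    | add y y' hy hy' => simp only [map_add, hy, hy']
    | tmul c n => exact congrArg (· ⊗ₜ[k] p.rep' g n) (α.map_mul g a c)
  rep_right g x y := by
    change (α.rep.tprod p.rep') g (elemRight A p.toDualPair (e.toEquiv x) y) =
      elemRight A p.toDualPair (e.toEquiv (γ.rep g x)) ((α.rep.tprod p.rep') g y)
    rw [elemRight_equivariant, e.equivariant]

/-- The bimodule `A ⊗ M`. -/
noncomputable def elemQ : PreBimodule γ α where
  carrier := A ⊗[k] p.M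
  left :=
    { toFun := fun x => elemLeft A p.toDualPair (e.toEquiv x)
      map_smul' := fun c x => by simp only [map_smul]; rfl
      map_zero' := by simp only [map_zero]
      map_add' := fun x y => by simp only [map_add]
      map_mul' := fun x y => by simp only [e.map_mul, elemLeft_mul] }
  right := rightAction (mulRightTensor A p.M) fun a b => by
    ext c n
    exact congrArg (· ⊗ₜ[k] n) (mul_assoc c a b).symm
  comm x a y := by
    change elemLeft A p.toDualPair (e.toEquiv x) (mulRightTensor A p.M a.unop y) =
      mulRightTensor A p.M a.unop (elemLeft A p.toDualPair (e.toEquiv x) y)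
    induction e.toEquiv x with
    | zero => simp only [map_zero, LinearMap.zero_apply]
    | add x x' hx hx' => simp only [map_add, LinearMap.add_apply, hx, hx']
    | tmul b x =>
      induction y with
      | zero => simp only [map_zero]
      | add y y' hy hy' => simp only [map_add, hy, hy']
      | tmul c n =>
        exact congrArg (· ⊗ₜ[k] Elem.action p.toDualPair x n) (mul_assoc b c a.unop).symm
  rep := α.rep.tprod p.rep
  rep_left g x y := by
    change (α.rep.tprod p.rep) g (elemLeft A p.toDualPair (e.toEquiv x) y) =
      elemLeft A p.toDualPair (e.toEquiv (γ.rep g x)) ((α.rep.tprod p.rep) g y)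
    rw [elemLeft_equivariant, e.equivariant]
  rep_right g a y := by
    induction y with
    | zero => simp only [map_zero]
    | add y y' hy hy' => simp only [map_add, hy, hy']
    | tmul c n => exact congrArg (· ⊗ₜ[k] p.rep g n) (α.map_mul g c a)

/-- The pairing `(x ⊗ m', y ⊗ m) ↦ μ(m' ⊗ m) x y`. -/
noncomputable def elemF (A : Type u) [NonUnitalRing A] [Module k A]
    [IsScalarTower k A A] [SMulCommClass k A A] (p : DualPair k) :
    A ⊗[k] p.M' →ₗ[k] A ⊗[k] p.M →ₗ[k] A :=
  TensorProduct.curry (TensorProduct.lift (LinearMap.mk₂ k (fun x c => c • x)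
      (fun _ _ _ => smul_add _ _ _) (fun _ _ _ => smul_comm _ _ _) (fun _ _ _ => add_smul _ _ _)
      (fun _ _ _ => mul_smul _ _ _)) ∘ₗ
    TensorProduct.map (LinearMap.mul' k A) p.μ ∘ₗ
    (TensorProduct.tensorTensorTensorComm k A p.M' A p.M).toLinearMap)

/-- The pairing `(y ⊗ m, x ⊗ m') ↦ y x ⊗ (m ⊗ m')`. -/
noncomputable def elemH (A : Type u) [NonUnitalRing A] [Module k A]
    [IsScalarTower k A A] [SMulCommClass k A A] (p : DualPair k) :
    A ⊗[k] p.M →ₗ[k] A ⊗[k] p.M' →ₗ[k] A ⊗[k] Elem p :=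
  TensorProduct.curry (TensorProduct.map (LinearMap.mul' k A)
      (TensorProduct.lift (Elem.tmulBilin p)) ∘ₗ
    (TensorProduct.tensorTensorTensorComm k A p.M A p.M').toLinearMap)

end ElementaryContext

/-! ### The pairings of A ⊗ M' with A ⊗ M, and the resulting Morita context -/

section ElementaryContext

variable {k : Type u} [CommRing k] {G : Type v} [Group G] {A C : Type u}
    [NonUnitalRing A] [Module k A] [IsScalarTower k A A] [SMulCommClass k A A]
    [NonUnitalRing C] [Module k C] [IsScalarTower k C C] [SMulCommClass k C C]
    {α : AlgAction k G A} {γ : AlgAction k G C}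

theorem tensor_ext₂ {X Y Z W R : Type*} [AddCommGroup X] [Module k X] [AddCommGroup Y] [Module k Y]
    [AddCommGroup Z] [Module k Z] [AddCommGroup W] [Module k W] [AddCommGroup R] [Module k R]
    {f g : X ⊗[k] Y →ₗ[k] Z ⊗[k] W →ₗ[k] R}
    (h : ∀ x y z w, f (x ⊗ₜ y) (z ⊗ₜ w) = g (x ⊗ₜ y) (z ⊗ₜ w)) : f = g :=
  TensorProduct.ext' fun x y => TensorProduct.ext' fun z w => h x y z w

/-- For z = c ⊗ (n ⊗ n') both sides are abc times the scalar μ(m' ⊗ n)μ(n' ⊗ m). -/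
theorem elemF_balanced (p : DualPair k) (z : A ⊗[k] Elem p) (x : A ⊗[k] p.M') (y : A ⊗[k] p.M) :
    elemF A p (elemRight A p z x) y = elemF A p x (elemLeft A p z y) := by
  refine LinearMap.congr_fun₂ (f := elemF A p ∘ₗ elemRight A p z)
    (g := (elemF A p).compl₂ (elemLeft A p z)) (tensor_ext₂ fun a m' b m => ?_) x y
  refine LinearMap.congr_fun (f := (elemF A p).flip (b ⊗ₜ m) ∘ₗ (elemRight A p).flip (a ⊗ₜ m'))
    (g := elemF A p (a ⊗ₜ m') ∘ₗ (elemLeft A p).flip (b ⊗ₜ m))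
    (generates_tmul_elem A p fun c n n' => ?_) z
  change p.μ ((p.μ (m' ⊗ₜ n) • n') ⊗ₜ m) • (a * c * b) =
    p.μ (m' ⊗ₜ (p.μ (n' ⊗ₜ m) • n)) • (a * (c * b))
  rw [TensorProduct.tmul_smul, ← TensorProduct.smul_tmul', map_smul, map_smul, smul_eq_mul,
    smul_eq_mul, mul_comm, mul_assoc]

theorem elemH_left (p : DualPair k) (z : A ⊗[k] Elem p) (y : A ⊗[k] p.M) (x : A ⊗[k] p.M') :
    elemH A p (elemLeft A p z y) x = z * elemH A p y x := by
  refine LinearMap.congr_fun₂ (f := elemH A p ∘ₗ elemLeft A p z)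
    (g := (elemH A p).compr₂ (LinearMap.mulLeft k z)) (tensor_ext₂ fun b m a m' => ?_) y x
  refine LinearMap.congr_fun (f := (elemH A p).flip (a ⊗ₜ m') ∘ₗ (elemLeft A p).flip (b ⊗ₜ m))
    (g := LinearMap.mulRight k (elemH A p (b ⊗ₜ m) (a ⊗ₜ m')))
    (generates_tmul_elem A p fun c n n' => ?_) z
  change (c * b * a) ⊗ₜ Elem.tmulBilin p (p.μ (n' ⊗ₜ m) • n) m' =
    (c ⊗ₜ[k] Elem.tmul p n n') * ((b * a) ⊗ₜ[k] Elem.tmul p m m')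
  rw [Algebra.TensorProduct.tmul_mul_tmul, Elem.tmul_mul_tmul, mul_assoc, map_smul]
  rfl

theorem elemH_right (p : DualPair k) (z : A ⊗[k] Elem p) (y : A ⊗[k] p.M) (x : A ⊗[k] p.M') :
    elemH A p y (elemRight A p z x) = elemH A p y x * z := by
  refine LinearMap.congr_fun₂ (f := (elemH A p).compl₂ (elemRight A p z))
    (g := (elemH A p).compr₂ (LinearMap.mulRight k z)) (tensor_ext₂ fun b m a m' => ?_) y x
  refine LinearMap.congr_fun (f := elemH A p (b ⊗ₜ m) ∘ₗ (elemRight A p).flip (a ⊗ₜ m'))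
    (g := LinearMap.mulLeft k (elemH A p (b ⊗ₜ m) (a ⊗ₜ m')))
    (generates_tmul_elem A p fun c n n' => ?_) z
  change (b * (a * c)) ⊗ₜ Elem.tmulBilin p m (p.μ (m' ⊗ₜ n) • n') =
    ((b * a) ⊗ₜ[k] Elem.tmul p m m') * (c ⊗ₜ[k] Elem.tmul p n n')
  rw [Algebra.TensorProduct.tmul_mul_tmul, Elem.tmul_mul_tmul, mul_assoc, map_smul]
  rfl

theorem elem_assoc_right (p : DualPair k) (x x' : A ⊗[k] p.M') (y : A ⊗[k] p.M) :
    tensorAction (NonUnitalAlgHom.lmul k A) p.M' (elemF A p x y) x' =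
      elemRight A p (elemH A p y x') x := by
  induction x' with
  | zero => simp only [map_zero, LinearMap.zero_apply]
  | add x' x'' h h' => simp only [map_add, LinearMap.add_apply, h, h']
  | tmul c n' =>
    refine LinearMap.congr_fun₂ (f := (elemF A p).compr₂
        ((tensorAction (NonUnitalAlgHom.lmul k A) p.M' :
          A →ₗ[k] Module.End k (A ⊗[k] p.M')).flip (c ⊗ₜ n')))
      (g := (elemRight A p ∘ₗ (elemH A p).flip (c ⊗ₜ n')).flip)
      (tensor_ext₂ fun a m' b m => ?_) x y
    change ((p.μ (m' ⊗ₜ m) • (a * b)) * c) ⊗ₜ n' = (a * (b * c)) ⊗ₜ (p.μ (m' ⊗ₜ m) • n')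
    rw [TensorProduct.tmul_smul, TensorProduct.smul_tmul', smul_mul_assoc, mul_assoc]

theorem elem_assoc_left (p : DualPair k) (y y' : A ⊗[k] p.M) (x : A ⊗[k] p.M') :
    elemLeft A p (elemH A p y x) y' = mulRightTensor A p.M (elemF A p x y') y := by
  induction y' with
  | zero => simp only [map_zero, LinearMap.zero_apply]
  | add x' x'' h h' => simp only [map_add, LinearMap.add_apply, h, h']
  | tmul c n =>
    refine LinearMap.congr_fun₂ (f := (elemH A p).compr₂ ((elemLeft A p).flip (c ⊗ₜ n)))
      (g := (mulRightTensor A p.M ∘ₗ (elemF A p).flip (c ⊗ₜ n)).flip)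
      (tensor_ext₂ fun b m a m' => ?_) y x
    change (b * a * c) ⊗ₜ (p.μ (m' ⊗ₜ n) • m) = (b * (p.μ (m' ⊗ₜ n) • (a * c))) ⊗ₜ m
    rw [TensorProduct.tmul_smul, TensorProduct.smul_tmul', mul_smul_comm, mul_assoc]

/-- N is moved into the target: a map on A × (M ⊗ N) is a map on A × M with values in Hom(N, R). -/
theorem tensorAction_isFirm {M : Type u} [AddCommGroup M] [Module k M]
    {ρ : A →ₙₐ[k] Module.End k M} (hρ : IsFirm ρ) (N : Type u) [AddCommGroup N] [Module k N] :
    IsFirm (tensorAction ρ N) where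
  generates S hS := generates_mk S fun m n =>
    hρ.generates (S.comap ((TensorProduct.mk k M N).flip n)) (fun a m => hS a (m ⊗ₜ n)) m
  exists_lift {R} _ _ φ hφ := by
    obtain ⟨s, hs⟩ := hρ.exists_lift (R := N →ₗ[k] R)
      (LinearMap.mk₂ k (fun a m => φ a ∘ₗ TensorProduct.mk k M N m)
        (fun a b m => by ext; simp) (fun c a m => by ext; simp)
        (fun a m m' => by ext; simp) (fun c a m => by ext; simp))
      (fun a b m => LinearMap.ext fun n => hφ a b (m ⊗ₜ n))
    refine ⟨TensorProduct.lift s, fun a x => ?_⟩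
    exact LinearMap.congr_fun (f := TensorProduct.lift s ∘ₗ tensorAction ρ N a) (g := φ a)
      (TensorProduct.ext' fun m n => LinearMap.congr_fun (hs a m) n) x

/-- Since 1 is a sum of values of μ, w is the sum of the corresponding multiples. This is how
surjectivity of μ enters the context between A and A ⊗ E(M). -/
theorem DualPair.mem_of_forall_smul_mem {W : Type*} [AddCommGroup W] [Module k W] (p : DualPair k)
    (S : Submodule k W) (w : W) (h : ∀ m' m, p.μ (m' ⊗ₜ m) • w ∈ S) : w ∈ S := by
  obtain ⟨t, ht⟩ := p.surjective 1
  have := generates_mk (S.comap (LinearMap.toSpanSingleton k W w ∘ₗ p.μ)) h t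
  simpa [ht] using this

theorem elemLeft_generates (hA : ActionGenerates (NonUnitalAlgHom.lmul k A)) (p : DualPair k) :
    Generates (elemLeft A p) := fun S hS => generates_mk S fun a m =>
  hA (S.comap ((TensorProduct.mk k A p.M).flip m)) (fun b c =>
    p.mem_of_forall_smul_mem _ _ fun m' n => by
      have := hS (b ⊗ₜ Elem.tmul p m m') (c ⊗ₜ n)
      rw [elemLeft_tmul, Elem.action_tmul, TensorProduct.tmul_smul] at this
      exact this) a

/-- The context between `A` and an algebra isomorphic to `A ⊗ E(M)`. -/
noncomputable def elemContext (hA : ActionGenerates (NonUnitalAlgHom.lmul k A))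
    (p : GDualPair k G) (e : γ.Iso (α.tensor p.algAction)) : PreContext α γ where
  P := elemP p e
  Q := elemQ p e
  f := elemF A p.toDualPair
  h := (elemH A p.toDualPair).compr₂ e.toEquiv.symm.toLinearMap
  f_balanced b x y := elemF_balanced p.toDualPair (e.toEquiv b) x y
  h_balanced a y x := congrArg e.toEquiv.symm <| LinearMap.congr_fun₂
    (f := elemH A p.toDualPair ∘ₗ mulRightTensor A p.M a)
    (g := (elemH A p.toDualPair).compl₂ (tensorAction (NonUnitalAlgHom.lmul k A) p.M' a))
    (tensor_ext₂ fun b m c m' => congrArg (· ⊗ₜ[k] Elem.tmul p.toDualPair m m')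
      (mul_assoc b a c)) y x
  f_left a x y := LinearMap.congr_fun₂
    (f := elemF A p.toDualPair ∘ₗ tensorAction (NonUnitalAlgHom.lmul k A) p.M' a)
    (g := (elemF A p.toDualPair).compr₂ (LinearMap.mulLeft k a))
    (tensor_ext₂ fun b m' c m => by
      change p.μ (m' ⊗ₜ m) • (a * b * c) = a * (p.μ (m' ⊗ₜ m) • (b * c))
      rw [mul_smul_comm, mul_assoc]) x y
  f_right a x y := LinearMap.congr_fun₂
    (f := (elemF A p.toDualPair).compl₂ (mulRightTensor A p.M a))
    (g := (elemF A p.toDualPair).compr₂ (LinearMap.mulRight k a))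
    (tensor_ext₂ fun b m' c m => by
      change p.μ (m' ⊗ₜ m) • (b * (c * a)) = (p.μ (m' ⊗ₜ m) • (b * c)) * a
      rw [smul_mul_assoc, mul_assoc]) x y
  h_left b (y : A ⊗[k] p.M) (x : A ⊗[k] p.M') := by
    change e.toEquiv.symm (elemH A p.toDualPair (elemLeft A p.toDualPair (e.toEquiv b) y) x) =
      b * e.toEquiv.symm (elemH A p.toDualPair y x)
    rw [LinearEquiv.symm_apply_eq, e.map_mul, elemH_left, LinearEquiv.apply_symm_apply]
  h_right b (y : A ⊗[k] p.M) (x : A ⊗[k] p.M') := by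
    change e.toEquiv.symm (elemH A p.toDualPair y (elemRight A p.toDualPair (e.toEquiv b) x)) =
      e.toEquiv.symm (elemH A p.toDualPair y x) * b
    rw [LinearEquiv.symm_apply_eq, e.map_mul, elemH_right, LinearEquiv.apply_symm_apply]
  f_equivariant g x y := LinearMap.congr_fun₂
    (f := (elemF A p.toDualPair).compl₁₂ ((α.rep.tprod p.rep') g) ((α.rep.tprod p.rep) g))
    (g := (elemF A p.toDualPair).compr₂ (α.rep g))
    (tensor_ext₂ fun b m' c m => by
      change p.μ (p.rep' g m' ⊗ₜ p.rep g m) • (α.rep g b * α.rep g c) =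
        α.rep g (p.μ (m' ⊗ₜ m) • (b * c))
      rw [p.invariant, map_smul, α.map_mul]) x y
  h_equivariant g y x := by
    change e.toEquiv.symm (elemH A p.toDualPair ((α.rep.tprod p.rep) g y)
      ((α.rep.tprod p.rep') g x)) = γ.rep g (e.toEquiv.symm (elemH A p.toDualPair y x))
    rw [LinearEquiv.symm_apply_eq, e.equivariant, LinearEquiv.apply_symm_apply]
    exact LinearMap.congr_fun₂
      (f := (elemH A p.toDualPair).compl₁₂ ((α.rep.tprod p.rep) g) ((α.rep.tprod p.rep') g))
      (g := (elemH A p.toDualPair).compr₂ ((α.tensor p.algAction).rep g))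
      (tensor_ext₂ fun b m c m' => congrArg
        (· ⊗ₜ[k] Elem.tmul p.toDualPair (p.rep g m) (p.rep' g m')) (α.map_mul g b c).symm) y x
  assoc_P (x : A ⊗[k] p.M') (y : A ⊗[k] p.M) (x' : A ⊗[k] p.M') := by
    change tensorAction (NonUnitalAlgHom.lmul k A) p.M' (elemF A p.toDualPair x y) x' =
      elemRight A p.toDualPair (e.toEquiv (e.toEquiv.symm (elemH A p.toDualPair y x'))) x
    rw [LinearEquiv.apply_symm_apply, elem_assoc_right]
  assoc_Q (y : A ⊗[k] p.M) (x : A ⊗[k] p.M') (y' : A ⊗[k] p.M) := by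
    change elemLeft A p.toDualPair (e.toEquiv (e.toEquiv.symm (elemH A p.toDualPair y x))) y' =
      mulRightTensor A p.M (elemF A p.toDualPair x y') y
    rw [LinearEquiv.apply_symm_apply, elem_assoc_left]
  P_generates S hS := generates_mk S fun m n =>
    hA (S.comap ((TensorProduct.mk k A p.M').flip n)) (fun a m => hS a (m ⊗ₜ n)) m
  Q_generates S hS := elemLeft_generates hA p.toDualPair S fun z y => by
    have := hS (e.toEquiv.symm z) y
    change elemLeft A p.toDualPair (e.toEquiv (e.toEquiv.symm z)) y ∈ S at this
    rwa [LinearEquiv.apply_symm_apply] at this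
  f_generates S hS := hA S fun a b =>
    p.toDualPair.mem_of_forall_smul_mem _ _ fun m' m => hS (a ⊗ₜ m') (b ⊗ₜ m)
  h_generates S hS x := by
    have : ∀ z, z ∈ S.comap e.toEquiv.symm.toLinearMap := by
      refine generates_mk _ fun a w => ?_
      refine hA ((S.comap e.toEquiv.symm.toLinearMap).comap
        ((TensorProduct.mk k A (Elem p.toDualPair)).flip w)) (fun b c => ?_) a
      refine Elem.generates p.toDualPair ((S.comap e.toEquiv.symm.toLinearMap).comap
        (TensorProduct.mk k A (Elem p.toDualPair) (b * c))) (fun m m' => ?_) w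
      exact hS (b ⊗ₜ m) (c ⊗ₜ m')
    simpa using this (e.toEquiv x)

/-- Both contexts share the algebra A ⊗ E(M), the isomorphism e being built into the second. In the
composite, the first tensor factor of P is A ⊗ M' and that of Q is B ⊗ N'; these are unital on the
left over A and B, which is all that `toStrict` asks of the bimodules. -/
theorem strictContext_of_iso {B : Type u} [NonUnitalRing B] [Module k B] [IsScalarTower k B B]
    [SMulCommClass k B B] {β : AlgAction k G B} (hA : IsUnitalAlgebra k A)
    (hB : IsUnitalAlgebra k B) (p q : GDualPair k G)
    (e : (α.tensor p.algAction).Iso (β.tensor q.algAction)) :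
    Nonempty (StrictGMoritaContext α β) :=
  have hA' : IsFirm (NonUnitalAlgHom.lmul k A) := IsUnitalLeft.isFirm hA
  have hB' : IsFirm (NonUnitalAlgHom.lmul k B) := IsUnitalLeft.isFirm hB
  let c := elemContext hA'.generates p
    (⟨LinearEquiv.refl k _, fun _ _ => rfl, fun _ _ => rfl⟩ :
      (α.tensor p.algAction).Iso (α.tensor p.algAction))
  let d := elemContext hB'.generates q e
  ⟨(c.trans d.symm).toStrict hA' hB'
    (PreBimodule.tensor_isFirm _ _ (tensorAction_isFirm hA' _))
    (PreBimodule.tensor_isFirm _ _ (tensorAction_isFirm hB' _))⟩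

end ElementaryContext

/-! ### Isomorphisms of `G`-module algebras -/

namespace AlgAction

variable {k : Type u} [CommRing k] {G : Type v} [Group G] {A B C : Type u}
    [NonUnitalRing A] [Module k A] [IsScalarTower k A A] [SMulCommClass k A A]
    [NonUnitalRing B] [Module k B] [IsScalarTower k B B] [SMulCommClass k B B]
    [NonUnitalRing C] [Module k C] [IsScalarTower k C C] [SMulCommClass k C C]
    {α : AlgAction k G A} {β : AlgAction k G B} {γ : AlgAction k G C}

def Iso.symm (e : α.Iso β) : β.Iso α where
  toEquiv := e.toEquiv.symm
  map_mul a b := by rw [LinearEquiv.symm_apply_eq, e.map_mul]; simp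
  equivariant g a := by rw [LinearEquiv.symm_apply_eq, e.equivariant]; simp

def Iso.trans (e : α.Iso β) (f : β.Iso γ) : α.Iso γ where
  toEquiv := e.toEquiv.trans f.toEquiv
  map_mul a b := by simp [e.map_mul, f.map_mul]
  equivariant g a := by simp [e.equivariant, f.equivariant]

theorem tensor_map_mul {X : Type u} [NonUnitalRing X] [Module k X] [IsScalarTower k X X]
    [SMulCommClass k X X] (f : A ⊗[k] B →ₗ[k] X)
    (h : ∀ a b a' b', f ((a * a') ⊗ₜ (b * b')) = f (a ⊗ₜ b) * f (a' ⊗ₜ b')) (x y : A ⊗[k] B) :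
    f (x * y) = f x * f y :=
  LinearMap.congr_fun₂ (f := (LinearMap.mul k (A ⊗[k] B)).compr₂ f)
    (g := (LinearMap.mul k X).compl₁₂ f f) (tensor_ext₂ fun a b a' b' => by
      simp [Algebra.TensorProduct.tmul_mul_tmul, h]) x y

/-- `C ⊗ A ≅ C ⊗ B` for `A ≅ B`. -/
noncomputable def Iso.lTensor (γ : AlgAction k G C) (e : α.Iso β) :
    (γ.tensor α).Iso (γ.tensor β) where
  toEquiv := e.toEquiv.lTensor C
  map_mul x y := tensor_map_mul (e.toEquiv.lTensor C).toLinearMap (fun c a c' a' => by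
    simp [e.map_mul]) x y
  equivariant g x := LinearMap.congr_fun
    (f := (e.toEquiv.lTensor C).toLinearMap ∘ₗ (γ.tensor α).rep g)
    (g := (γ.tensor β).rep g ∘ₗ (e.toEquiv.lTensor C).toLinearMap)
    (TensorProduct.ext' fun c a => congrArg (γ.rep g c ⊗ₜ[k] ·) (e.equivariant g a)) x

/-- `A ⊗ (B ⊗ C) ≅ B ⊗ (A ⊗ C)`. -/
noncomputable def Iso.leftComm (α : AlgAction k G A) (β : AlgAction k G B) (γ : AlgAction k G C) :
    (α.tensor (β.tensor γ)).Iso (β.tensor (α.tensor γ)) where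
  toEquiv := TensorProduct.leftComm k A B C
  map_mul := by
    refine tensor_map_mul (k := k) (A := A) (B := B ⊗[k] C) (X := B ⊗[k] (A ⊗[k] C))
      (TensorProduct.leftComm k A B C).toLinearMap fun a x a' x' => ?_
    refine LinearMap.congr_fun₂
      (f := (LinearMap.mul k (B ⊗[k] C)).compr₂
        ((TensorProduct.leftComm k A B C).toLinearMap ∘ₗ TensorProduct.mk k _ _ (a * a')))
      (g := (LinearMap.mul k (B ⊗[k] (A ⊗[k] C))).compl₁₂
        ((TensorProduct.leftComm k A B C).toLinearMap ∘ₗ TensorProduct.mk k _ _ a)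
        ((TensorProduct.leftComm k A B C).toLinearMap ∘ₗ TensorProduct.mk k _ _ a'))
      (tensor_ext₂ fun b c b' c' => ?_) x x'
    simp [Algebra.TensorProduct.tmul_mul_tmul]
  equivariant g x := LinearMap.congr_fun
    (f := (TensorProduct.leftComm k A B C).toLinearMap ∘ₗ (α.tensor (β.tensor γ)).rep g)
    (g := (β.tensor (α.tensor γ)).rep g ∘ₗ (TensorProduct.leftComm k A B C).toLinearMap)
    (TensorProduct.ext (LinearMap.ext fun a => TensorProduct.ext' fun b c => rfl)) x

end AlgAction

/-! ### The algebra `A ⊗ Bᵒᵖ` of a Morita context is elementary -/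

section Dual

variable {k : Type u} [CommRing k] {G : Type v} [Group G] {A B : Type u}
    [NonUnitalRing A] [Module k A] [IsScalarTower k A A] [SMulCommClass k A A]
    [NonUnitalRing B] [Module k B] [IsScalarTower k B B] [SMulCommClass k B B]
    {α : AlgAction k G A} {β : AlgAction k G B}

/-- The left `B`-module `N ⊗ P`, for a left `B`-module `P` and a `k`-module `N`. -/
noncomputable def tensorActionRight {P : Type u} [AddCommGroup P] [Module k P]
    (N : Type u) [AddCommGroup N] [Module k N] (ρ : B →ₙₐ[k] Module.End k P) :
    B →ₙₐ[k] Module.End k (N ⊗[k] P) where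
  toFun a := (ρ a).lTensor N
  map_smul' c a := by simp [LinearMap.lTensor_smul]
  map_zero' := by simp
  map_add' a b := by simp [LinearMap.lTensor_add]
  map_mul' a b := by simp [LinearMap.lTensor_mul]

theorem tensorActionRight_isFirm {M : Type u} [AddCommGroup M] [Module k M]
    {ρ : B →ₙₐ[k] Module.End k M} (hρ : IsFirm ρ) (N : Type u) [AddCommGroup N] [Module k N] :
    IsFirm (tensorActionRight N ρ) where
  generates S hS := generates_mk S fun n m =>
    hρ.generates (S.comap (TensorProduct.mk k N M n)) (fun a m => hS a (n ⊗ₜ m)) m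
  exists_lift {R} _ _ φ hφ := by
    obtain ⟨s, hs⟩ := hρ.exists_lift (R := N →ₗ[k] R)
      (LinearMap.mk₂ k (fun a m => φ a ∘ₗ (TensorProduct.mk k N M).flip m)
        (fun a b m => by ext; simp) (fun c a m => by ext; simp)
        (fun a m m' => by ext; simp) (fun c a m => by ext; simp))
      (fun a b m => LinearMap.ext fun n => hφ a b (n ⊗ₜ m))
    refine ⟨TensorProduct.lift s.flip, fun a x => ?_⟩
    exact LinearMap.congr_fun (f := TensorProduct.lift s.flip ∘ₗ tensorActionRight N ρ a) (g := φ a)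
      (TensorProduct.ext' fun n m => LinearMap.congr_fun (hs a m) n) x

theorem op_generates (hA : ActionGenerates (NonUnitalAlgHom.lmul k A)) :
    ActionGenerates (NonUnitalAlgHom.lmul k Aᵐᵒᵖ) := fun S hS x =>
  hA (S.comap (MulOpposite.opLinearEquiv k : A ≃ₗ[k] Aᵐᵒᵖ).toLinearMap)
    (fun a b => hS (MulOpposite.op b) (MulOpposite.op a)) x.unop

/-- A = AAA, because A is spanned by its products. It replaces 1 · x · 1 = x. -/
theorem envAction_generates (hA : ActionGenerates (NonUnitalAlgHom.lmul k A))
    (S : Submodule k A) (hS : ∀ a x b, a * (x * b) ∈ S) (x : A) : x ∈ S :=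
  hA S (fun a y => hA (S.comap (LinearMap.mulLeft k a)) (fun z b => hS a z b) y) x

theorem envAction_equivariant (α : AlgAction k G A) (g : G) (z : A ⊗[k] Aᵐᵒᵖ) (x : A) :
    α.rep g (envAction k A z x) = envAction k A ((α.tensor α.op).rep g z) (α.rep g x) :=
  LinearMap.congr_fun
    (f := α.rep g ∘ₗ (envAction k A : A ⊗[k] Aᵐᵒᵖ →ₗ[k] Module.End k A).flip x)
    (g := (envAction k A : A ⊗[k] Aᵐᵒᵖ →ₗ[k] Module.End k A).flip (α.rep g x) ∘ₗ
      (α.tensor α.op).rep g)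
    (TensorProduct.ext' fun a b => by
      change α.rep g (a * (x * b.unop)) = α.rep g a * (α.rep g x * α.rep g b.unop)
      rw [α.map_mul, α.map_mul]) z

/-! ### From a Morita context to a dual pair -/

namespace PreContext

variable (c : PreContext α β)

/-- The `Aᵉ`-module `A ⊗ Q`. -/
noncomputable def coeffAction : A ⊗[k] Aᵐᵒᵖ →ₙₐ[k] Module.End k (A ⊗[k] c.Q.carrier) :=
  commAction (tensorAction (NonUnitalAlgHom.lmul k A) c.Q.carrier)
    (tensorActionRight A c.Q.right) fun a b m => LinearMap.congr_fun
      (f := tensorAction (NonUnitalAlgHom.lmul k A) c.Q.carrier a ∘ₗ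
        tensorActionRight A c.Q.right b)
      (g := tensorActionRight A c.Q.right b ∘ₗ
        tensorAction (NonUnitalAlgHom.lmul k A) c.Q.carrier a)
      (TensorProduct.ext' fun _ _ => rfl) m

/-- This makes the counit of the Taylor–Azumaya adjunction available for A ⊗ Q: A is unital on the
left over itself and Q on the right over A. -/
theorem coeffAction_isUnitalLeft (hA : IsFirm (NonUnitalAlgHom.lmul k A))
    (hQ : IsFirm c.Q.right) : IsUnitalLeft c.coeffAction :=
  (commAction_isFirm hA.generates (op_generates hA.generates) _ (tensorAction_isFirm hA _)
    (tensorActionRight_isFirm hQ _)).isUnitalLeft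

theorem coeffAction_equivariant (g : G) (z : A ⊗[k] Aᵐᵒᵖ) (x : A ⊗[k] c.Q.carrier) :
    (α.rep.tprod c.Q.rep) g (c.coeffAction z x) =
      c.coeffAction ((α.tensor α.op).rep g z) ((α.rep.tprod c.Q.rep) g x) :=
  LinearMap.congr_fun₂
    (f := (c.coeffAction : A ⊗[k] Aᵐᵒᵖ →ₗ[k] Module.End k (A ⊗[k] c.Q.carrier)).compr₂
      ((α.rep.tprod c.Q.rep) g))
    (g := (c.coeffAction : A ⊗[k] Aᵐᵒᵖ →ₗ[k] Module.End k (A ⊗[k] c.Q.carrier)).compl₁₂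
      ((α.tensor α.op).rep g) ((α.rep.tprod c.Q.rep) g))
    (tensor_ext₂ fun a b x q => by
      change α.rep g (a * x) ⊗ₜ[k] c.Q.rep g (c.Q.right (MulOpposite.op b.unop) q) =
        (α.rep g a * α.rep g x) ⊗ₜ[k]
          c.Q.right (MulOpposite.op (α.rep g b.unop)) (c.Q.rep g q)
      rw [α.map_mul, c.Q.rep_right]) z x

/-- The `k`-module `Hom_{Aᵉ}(A, A ⊗ Q)`. -/
noncomputable abbrev dual : Submodule k (A →ₗ[k] A ⊗[k] c.Q.carrier) :=
  homModule (envAction k A) c.coeffAction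

theorem dual_apply (η : c.dual) (a x b : A) : (η : A →ₗ[k] A ⊗[k] c.Q.carrier) (a * (x * b)) =
    (LinearMap.mulLeft k a).rTensor c.Q.carrier
      ((c.Q.right (MulOpposite.op b)).lTensor A (η.1 x)) :=
  η.2 (a ⊗ₜ MulOpposite.op b) x

/-- Linearity over Aᵉ only gives η(dyb) = dη(y)b. One-sided linearity follows because elements dyb
span A and a(dyb) = (ad)yb. -/
theorem dual_mul_left (hA : ActionGenerates (NonUnitalAlgHom.lmul k A)) (η : c.dual) (a x : A) :
    η.1 (a * x) = (LinearMap.mulLeft k a).rTensor c.Q.carrier (η.1 x) := by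
  refine envAction_generates hA (LinearMap.eqLocus (η.1 ∘ₗ LinearMap.mulLeft k a)
    ((LinearMap.mulLeft k a).rTensor c.Q.carrier ∘ₗ η.1)) (fun d y b => ?_) x
  change η.1 (a * (d * (y * b))) = (LinearMap.mulLeft k a).rTensor c.Q.carrier (η.1 (d * (y * b)))
  rw [← mul_assoc, dual_apply, dual_apply, ← LinearMap.rTensor_comp_apply,
    LinearMap.mulLeft_mul]

theorem dual_mul_right (hA : ActionGenerates (NonUnitalAlgHom.lmul k A)) (η : c.dual) (x a : A) :
    η.1 (x * a) = (c.Q.right (MulOpposite.op a)).lTensor A (η.1 x) := by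
  refine envAction_generates hA (LinearMap.eqLocus (η.1 ∘ₗ LinearMap.mulRight k a)
    ((c.Q.right (MulOpposite.op a)).lTensor A ∘ₗ η.1)) (fun d y b => ?_) x
  change η.1 (d * (y * b) * a) = (c.Q.right (MulOpposite.op a)).lTensor A (η.1 (d * (y * b)))
  rw [mul_assoc, mul_assoc, dual_apply, dual_apply, MulOpposite.op_mul, map_mul,
    LinearMap.lTensor_mul, ← LinearMap.comp_apply (LinearMap.lTensor A _),
    LinearMap.lTensor_comp_rTensor, ← LinearMap.rTensor_comp_lTensor]
  rfl

/-- The map `A ⊗ Q → A ⊗ Bᵒᵖ`, `x ⊗ q ↦ x ⊗ h(q, p)`. -/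
noncomputable def contract : c.P.carrier →ₗ[k] A ⊗[k] c.Q.carrier →ₗ[k] A ⊗[k] Bᵐᵒᵖ :=
  LinearMap.lTensorHom A ∘ₗ
    (c.h.compr₂ (MulOpposite.opLinearEquiv k : B ≃ₗ[k] Bᵐᵒᵖ).toLinearMap).flip

@[simp] theorem contract_tmul (p : c.P.carrier) (x : A) (q : c.Q.carrier) :
    c.contract p (x ⊗ₜ q) = x ⊗ₜ MulOpposite.op (c.h q p) := rfl

/-- The contraction is balanced over A, so it descends to (A ⊗ Q) ⊗_A P. -/
theorem contract_left (a : A) (p : c.P.carrier) (x : A ⊗[k] c.Q.carrier) :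
    c.contract (c.P.left a p) x =
      c.contract p ((c.Q.right (MulOpposite.op a)).lTensor A x) :=
  LinearMap.congr_fun (f := c.contract (c.P.left a p))
    (g := c.contract p ∘ₗ (c.Q.right (MulOpposite.op a)).lTensor A)
    (TensorProduct.ext' fun x q => by simp [c.h_balanced]) x

/-- Left multiplication by b in `Bᵐᵒᵖ` is right multiplication in B, and h(q, p)b = h(q, pb). -/
theorem contract_mul (a : A) (b : Bᵐᵒᵖ) (p : c.P.carrier) (x : A ⊗[k] c.Q.carrier) :
    (a ⊗ₜ b) * c.contract p x =
      c.contract (c.P.right b p) ((LinearMap.mulLeft k a).rTensor c.Q.carrier x) :=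
  LinearMap.congr_fun (f := LinearMap.mulLeft k (a ⊗ₜ[k] b) ∘ₗ c.contract p)
    (g := c.contract (c.P.right b p) ∘ₗ (LinearMap.mulLeft k a).rTensor c.Q.carrier)
    (TensorProduct.ext' fun x q => by
      change (a ⊗ₜ[k] b) * (x ⊗ₜ[k] MulOpposite.op (c.h q p)) =
        (a * x) ⊗ₜ[k] MulOpposite.op (c.h q (c.P.right (MulOpposite.op b.unop) p))
      rw [Algebra.TensorProduct.tmul_mul_tmul, c.h_right]
      rfl) x

theorem contract_equivariant (g : G) (p : c.P.carrier) (x : A ⊗[k] c.Q.carrier) :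
    c.contract (c.P.rep g p) ((α.rep.tprod c.Q.rep) g x) =
      (α.tensor β.op).rep g (c.contract p x) :=
  LinearMap.congr_fun (f := c.contract (c.P.rep g p) ∘ₗ (α.rep.tprod c.Q.rep) g)
    (g := (α.tensor β.op).rep g ∘ₗ c.contract p)
    (TensorProduct.ext' fun x q => by
      change α.rep g x ⊗ₜ[k] MulOpposite.op (c.h (c.Q.rep g q) (c.P.rep g p)) =
        α.rep g x ⊗ₜ[k] MulOpposite.op (β.rep g (c.h q p))
      rw [c.h_equivariant]) x

/-- The isomorphism `P ⊗ Hom_{Aᵉ}(A, A ⊗ Q) ≅ A ⊗ Bᵒᵖ`. -/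
theorem exists_dualEquiv (hA : IsTaylorAzumaya k A) (hB : IsUnitalAlgebra k B)
    (hP : IsFirm c.P.left) (hQ : IsFirm c.Q.right) :
    ∃ φ : c.P.carrier ⊗[k] c.dual ≃ₗ[k] A ⊗[k] Bᵐᵒᵖ, ∀ a p (η : c.dual),
      φ (c.P.left a p ⊗ₜ η) = c.contract p (η.1 a) := by
  have hA' : IsFirm (NonUnitalAlgHom.lmul k A) := IsUnitalLeft.isFirm hA.unital
  have hB' : IsFirm (NonUnitalAlgHom.lmul k B) := IsUnitalLeft.isFirm hB
  let ε := LinearEquiv.ofBijective _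
    (hA.counit_bijective _ c.coeffAction (c.coeffAction_isUnitalLeft hA' hQ))
  have hε : ∀ x (η : c.dual), ε (x ⊗ₜ η) = η.1 x := fun _ _ => rfl
  let hE := LinearEquiv.ofBijective c.symm.fLift
    ⟨c.symm.fLift_injective hB', c.symm.fLift_surjective⟩
  have hhE : ∀ q p, hE.symm (c.h q p) = btmul c.Q.right c.P.left q p := fun q p =>
    hE.symm_apply_eq.2 rfl
  -- The rule ap ⊗ η ↦ contraction of η(a) with p is well defined: η(ab) = η(a)b, and contracting zb
  -- with p is contracting z with bp.
  obtain ⟨s, hs⟩ := hP.exists_lift (R := c.dual →ₗ[k] A ⊗[k] Bᵐᵒᵖ)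
    (LinearMap.mk₂ k (fun a p => c.contract p ∘ₗ LinearMap.applyₗ a ∘ₗ c.dual.subtype)
      (fun a b p => by ext; simp) (fun r a p => by ext; simp)
      (fun a p p' => by ext; simp) (fun r a p => by ext; simp))
    (fun a b p => LinearMap.ext fun η => by
      change c.contract p (η.1 (a * b)) = c.contract (c.P.left b p) (η.1 a)
      rw [c.dual_mul_right hA'.generates, contract_left])
  let φ := TensorProduct.lift s
  have hφ : ∀ a p (η : c.dual), φ (c.P.left a p ⊗ₜ η) = c.contract p (η.1 a) :=
    fun a p η => LinearMap.congr_fun (hs a p) η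
  -- T p : x ⊗ η ↦ xp ⊗ η satisfies φ ∘ T p = contract p ∘ ε. The inverse of φ is therefore forced
  -- to send a ⊗ h(q, p) to T p (ε⁻¹(a ⊗ q)).
  let T : c.P.carrier →ₗ[k] A ⊗[k] c.dual →ₗ[k] c.P.carrier ⊗[k] c.dual :=
    LinearMap.rTensorHom c.dual ∘ₗ (c.P.left : A →ₗ[k] Module.End k c.P.carrier).flip
  have hT : ∀ p x η, T p (x ⊗ₜ η) = c.P.left x p ⊗ₜ η := fun _ _ _ => rfl
  have hφT : ∀ p z, φ (T p z) = c.contract p (ε z) := fun p z => LinearMap.congr_fun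
    (f := φ ∘ₗ T p) (g := c.contract p ∘ₗ ε.toLinearMap)
    (TensorProduct.ext' fun x η => hφ x p η) z
  have hεr : ∀ a z, ε ((LinearMap.mulRight k a).rTensor c.dual z) =
      (c.Q.right (MulOpposite.op a)).lTensor A (ε z) := fun a z => LinearMap.congr_fun
    (f := ε.toLinearMap ∘ₗ (LinearMap.mulRight k a).rTensor c.dual)
    (g := (c.Q.right (MulOpposite.op a)).lTensor A ∘ₗ ε.toLinearMap)
    (TensorProduct.ext' fun x η => c.dual_mul_right hA'.generates η x a) z
  have hTr : ∀ a p z, T p ((LinearMap.mulRight k a).rTensor c.dual z) = T (c.P.left a p) z :=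
    fun a p z => LinearMap.congr_fun (f := T p ∘ₗ (LinearMap.mulRight k a).rTensor c.dual)
      (g := T (c.P.left a p)) (TensorProduct.ext' fun x η => by
        change c.P.left (x * a) p ⊗ₜ[k] η = c.P.left x (c.P.left a p) ⊗ₜ[k] η
        rw [map_mul]
        rfl) z
  let W : c.Q.carrier →ₗ[k] c.P.carrier →ₗ[k] A →ₗ[k] c.P.carrier ⊗[k] c.dual :=
    LinearMap.mk₂ k (fun q p => T p ∘ₗ ε.symm.toLinearMap ∘ₗ
        (TensorProduct.mk k A c.Q.carrier).flip q)
      (fun q q' p => by ext a; simp only [LinearMap.comp_apply, map_add, LinearMap.add_apply])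
      (fun r q p => by ext a; simp only [LinearMap.comp_apply, map_smul, LinearMap.smul_apply])
      (fun q p p' => by ext a; simp only [LinearMap.comp_apply, map_add, LinearMap.add_apply])
      (fun r q p => by ext a; simp only [LinearMap.comp_apply, map_smul, LinearMap.smul_apply])
  have hW : ∀ q p a, W q p a = T p (ε.symm (a ⊗ₜ q)) := fun _ _ _ => rfl
  -- ε is right A-linear, with A acting on the factor A of the source and on Q in the target. Hence
  -- W is balanced and descends to Q ⊗_A P ≅ B.
  have hWb : ∀ a q p, W (c.Q.right (MulOpposite.op a) q) p = W q (c.P.left a p) :=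
    fun a q p => LinearMap.ext fun x => by
      rw [hW, hW, ← hTr]
      congr 1
      rw [LinearEquiv.symm_apply_eq, hεr, LinearEquiv.apply_symm_apply]
      rfl
  let ψ : A ⊗[k] Bᵐᵒᵖ →ₗ[k] c.P.carrier ⊗[k] c.dual :=
    TensorProduct.lift (balancedLift c.Q.right c.P.left W hWb ∘ₗ hE.symm.toLinearMap ∘ₗ
      (MulOpposite.opLinearEquiv k : B ≃ₗ[k] Bᵐᵒᵖ).symm.toLinearMap).flip
  have hψ₀ : ∀ a q p, ψ (a ⊗ₜ MulOpposite.op (c.h q p)) = T p (ε.symm (a ⊗ₜ q)) := fun a q p => by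
    change balancedLift c.Q.right c.P.left W hWb (hE.symm (c.h q p)) a = _
    rw [hhE]
    rfl
  have hψ : ∀ p z, ψ (c.contract p z) = T p (ε.symm z) := fun p z => LinearMap.congr_fun
    (f := ψ ∘ₗ c.contract p) (g := T p ∘ₗ ε.symm.toLinearMap)
    (TensorProduct.ext' fun a q => hψ₀ a q p) z
  refine ⟨LinearEquiv.ofLinearMap φ ψ ?_ ?_, hφ⟩
  · refine TensorProduct.ext (LinearMap.ext fun a => LinearMap.ext fun b => ?_)
    refine LinearMap.congr_fun (f := φ ∘ₗ ψ ∘ₗ TensorProduct.mk k A Bᵐᵒᵖ a ∘ₗ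
        (MulOpposite.opLinearEquiv k : B ≃ₗ[k] Bᵐᵒᵖ).toLinearMap)
      (g := TensorProduct.mk k A Bᵐᵒᵖ a ∘ₗ
        (MulOpposite.opLinearEquiv k : B ≃ₗ[k] Bᵐᵒᵖ).toLinearMap)
      (c.h_generates.ext fun q p => ?_) b.unop
    change φ (ψ (a ⊗ₜ MulOpposite.op (c.h q p))) = a ⊗ₜ MulOpposite.op (c.h q p)
    rw [hψ₀, hφT, LinearEquiv.apply_symm_apply, contract_tmul]
  · refine TensorProduct.ext (hP.generates.ext fun a p => LinearMap.ext fun η => ?_)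
    change ψ (φ (T p (a ⊗ₜ η))) = T p (a ⊗ₜ η)
    rw [hφT, hψ, LinearEquiv.symm_apply_apply]

/-- The left `A ⊗ Bᵒᵖ`-module `P`. -/
noncomputable def biaction : A ⊗[k] Bᵐᵒᵖ →ₙₐ[k] Module.End k c.P.carrier :=
  commAction c.P.left c.P.right c.P.comm

theorem biaction_generates : ActionGenerates c.biaction :=
  commAction_generates _ c.P_generates c.P_generates_right

theorem biaction_equivariant (g : G) (z : A ⊗[k] Bᵐᵒᵖ) (p : c.P.carrier) :
    c.P.rep g (c.biaction z p) = c.biaction ((α.tensor β.op).rep g z) (c.P.rep g p) :=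
  LinearMap.congr_fun
    (f := c.P.rep g ∘ₗ (c.biaction : A ⊗[k] Bᵐᵒᵖ →ₗ[k] Module.End k c.P.carrier).flip p)
    (g := (c.biaction : A ⊗[k] Bᵐᵒᵖ →ₗ[k] Module.End k c.P.carrier).flip (c.P.rep g p) ∘ₗ
      (α.tensor β.op).rep g)
    (TensorProduct.ext' fun a b => by
      change c.P.rep g (c.P.left a (c.P.right (MulOpposite.op b.unop) p)) =
        c.P.left (α.rep g a) (c.P.right (MulOpposite.op (β.rep g b.unop)) (c.P.rep g p))
      rw [c.P.rep_left, c.P.rep_right]) z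

/-- P inherits faithfulness from A, which is spanned by f(P, Q). This makes the scalars defining μ
unique, hence μ bilinear and invariant. -/
theorem eq_of_forall_smul_eq [FaithfulSMul k A] {r s : k}
    (h : ∀ p : c.P.carrier, r • p = s • p) : r = s := by
  refine FaithfulSMul.eq_of_smul_eq_smul (α := A) fun a => ?_
  refine LinearMap.congr_fun (f := r • LinearMap.id) (g := s • LinearMap.id)
    (c.f_generates.ext fun p q => ?_) a
  change r • c.f p q = s • c.f p q
  rw [← LinearMap.smul_apply, ← map_smul, h, map_smul, LinearMap.smul_apply]

/-- Bimodule endomorphisms of `P` are scalars. -/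
theorem exists_scalar (hA : IsTaylorAzumaya k A) (κ : Module.End k c.P.carrier)
    (hκ : ∀ z p, κ (c.biaction z p) = c.biaction z (κ p)) : ∃ r : k, ∀ p, κ p = r • p := by
  have hA' : IsFirm (NonUnitalAlgHom.lmul k A) := IsUnitalLeft.isFirm hA.unital
  have hκ' : ∀ a b p, κ (c.P.left a (c.P.right b p)) = c.P.left a (c.P.right b (κ p)) :=
    fun a b p => hκ (a ⊗ₜ b) p
  have hgen : ∀ S : Submodule k c.P.carrier, (∀ a b p, c.P.left a (c.P.right b p) ∈ S) →
      ∀ p, p ∈ S := fun S hS => c.P_generates S fun a p =>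
    c.P_generates_right (S.comap (c.P.left a)) (fun b p => hS a b p) p
  -- By assumption κ commutes only with the two-sided operations p ↦ apb. As the elements apb span
  -- P, it commutes with each side separately.
  have hl : ∀ a p, κ (c.P.left a p) = c.P.left a (κ p) := fun a =>
    hgen (LinearMap.eqLocus (κ ∘ₗ c.P.left a) (c.P.left a ∘ₗ κ)) fun d b p => by
      have := hκ' (a * d) b p
      rw [map_mul] at this
      change κ (c.P.left a (c.P.left d (c.P.right b p))) =
        c.P.left a (κ (c.P.left d (c.P.right b p)))
      rw [hκ' d b p]
      exact this
  have hr : ∀ b p, κ (c.P.right b p) = c.P.right b (κ p) := fun b =>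
    hgen (LinearMap.eqLocus (κ ∘ₗ c.P.right b) (c.P.right b ∘ₗ κ)) fun a d p => by
      have := hκ' a (b * d) p
      rw [map_mul] at this
      change κ (c.P.right b (c.P.left a (c.P.right d p))) =
        c.P.right b (κ (c.P.left a (c.P.right d p)))
      rw [hκ' a d p, ← c.P.comm, ← c.P.comm]
      exact this
  let e := LinearEquiv.ofBijective c.fLift ⟨c.fLift_injective hA', c.fLift_surjective⟩
  have hb : ∀ b p q, (c.f ∘ₗ κ) (c.P.right (MulOpposite.op b) p) q =
      (c.f ∘ₗ κ) p (c.Q.left b q) := fun b p q => by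
    rw [LinearMap.comp_apply, hr, c.f_balanced]
    rfl
  -- θ is κ ⊗ id on P ⊗_B Q, carried over to A; it is an Aᵉ-endomorphism.
  let θ : A →ₗ[k] A := balancedLift c.P.right c.Q.left (c.f ∘ₗ κ) hb ∘ₗ e.symm.toLinearMap
  have hθ : ∀ p q, θ (c.f p q) = c.f (κ p) q := fun p q => by
    have : e.symm (c.f p q) = btmul _ _ p q := e.symm_apply_eq.2 rfl
    change balancedLift c.P.right c.Q.left (c.f ∘ₗ κ) hb (e.symm (c.f p q)) = _
    rw [this]
    rfl
  have hθl : ∀ a b x, θ (a * (x * b)) = a * (θ x * b) := fun a b => by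
    refine LinearMap.congr_fun (f := θ ∘ₗ LinearMap.mulLeft k a ∘ₗ LinearMap.mulRight k b)
      (g := LinearMap.mulLeft k a ∘ₗ LinearMap.mulRight k b ∘ₗ θ)
      (c.f_generates.ext fun p q => ?_)
    change θ (a * (c.f p q * b)) = a * (θ (c.f p q) * b)
    rw [← c.f_right, ← c.f_left, hθ, hθ, hl, c.f_left, c.f_right]
  -- Surjectivity of the unit at the module k says that Aᵉ-endomorphisms of A are scalars.
  obtain ⟨r, hr'⟩ := (hA.unit_bijective k).2
    ⟨(TensorProduct.mk k A k).flip 1 ∘ₗ θ, fun z x => by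
      refine LinearMap.congr_fun (f := ((TensorProduct.mk k A k).flip 1 ∘ₗ θ) ∘ₗ
          (envAction k A : A ⊗[k] Aᵐᵒᵖ →ₗ[k] Module.End k A).flip x)
        (g := (tensorAction (envAction k A) k :
          A ⊗[k] Aᵐᵒᵖ →ₗ[k] Module.End k (A ⊗[k] k)).flip (θ x ⊗ₜ 1))
        (TensorProduct.ext' fun a b => ?_) z
      exact congrArg (· ⊗ₜ[k] (1 : k)) (hθl a b.unop x)⟩
  have hθr : ∀ x, θ x = r • x := fun x => by
    have h₁ : x ⊗ₜ[k] r = θ x ⊗ₜ[k] (1 : k) := LinearMap.congr_fun (congrArg Subtype.val hr') x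
    simpa using (congrArg (TensorProduct.rid k A) h₁).symm
  refine ⟨r, fun p => LinearMap.congr_fun (f := κ) (g := r • LinearMap.id)
    (c.P_generates.ext fun a p' => ?_) p⟩
  refine LinearMap.congr_fun
    (f := κ ∘ₗ (c.P.left : A →ₗ[k] Module.End k c.P.carrier).flip p')
    (g := r • (c.P.left : A →ₗ[k] Module.End k c.P.carrier).flip p')
    (c.f_generates.ext fun p q => ?_) a
  change κ (c.P.left (c.f p q) p') = r • c.P.left (c.f p q) p'
  -- κ(f(p, q)p') = κ(p h(q, p')) = κ(p)h(q, p') = f(κ(p), q)p' = θ(f(p, q))p'.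
  rw [c.assoc_P, hr, ← c.assoc_P, ← hθ, hθr, map_smul, LinearMap.smul_apply, c.assoc_P]

/-- The `G`-action on `Hom_{Aᵉ}(A, A ⊗ Q)` by conjugation. -/
noncomputable def dualRep : Representation k G c.dual where
  toFun g := (Representation.linHom α.rep (α.rep.tprod c.Q.rep) g).restrict fun η hη z x => by
    change (α.rep.tprod c.Q.rep) g (η (α.rep g⁻¹ (envAction k A z x))) =
      c.coeffAction z ((α.rep.tprod c.Q.rep) g (η (α.rep g⁻¹ x)))
    rw [envAction_equivariant, hη, coeffAction_equivariant, Representation.self_inv_apply]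
  map_one' := by
    ext1 η
    exact Subtype.ext (LinearMap.congr_fun
      (map_one (Representation.linHom α.rep (α.rep.tprod c.Q.rep))) η.1)
  map_mul' g h := by
    ext1 η
    exact Subtype.ext (LinearMap.congr_fun
      (map_mul (Representation.linHom α.rep (α.rep.tprod c.Q.rep)) g h) η.1)

theorem dualRep_apply (g : G) (η : c.dual) (x : A) :
    (c.dualRep g η).1 (α.rep g x) = (α.rep.tprod c.Q.rep) g (η.1 x) := by
  change (α.rep.tprod c.Q.rep) g (η.1 (α.rep g⁻¹ (α.rep g x))) = _
  rw [Representation.inv_self_apply]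

variable {N : Type u} [AddCommGroup N] [Module k N]

/-- Let I be the image of μ. Since A ⊗ Bᵒᵖ is spanned by the φ(x ⊗ η), its action gives P = IP,
hence A = IA and A ⊗ k/I = 0. Injectivity of the unit at k/I then forces k/I = 0. -/
theorem pairing_surjective (hA : IsTaylorAzumaya k A)
    (φ : c.P.carrier ⊗[k] N ≃ₗ[k] A ⊗[k] Bᵐᵒᵖ) (μ : N ⊗[k] c.P.carrier →ₗ[k] k)
    (hμ : ∀ η p x, c.biaction (φ (x ⊗ₜ η)) p = μ (η ⊗ₜ p) • x) : Function.Surjective μ := by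
  let bi : A ⊗[k] Bᵐᵒᵖ →ₗ[k] Module.End k c.P.carrier := c.biaction
  let I : Ideal k := LinearMap.range μ
  have h₁ : ∀ a : A, a ⊗ₜ[k] (Submodule.mkQ I 1) = 0 := by
    refine c.f_generates (LinearMap.ker ((TensorProduct.mk k A (k ⧸ I)).flip
      (Submodule.mkQ I 1))) fun p q => ?_
    refine c.biaction_generates ((LinearMap.ker ((TensorProduct.mk k A (k ⧸ I)).flip
      (Submodule.mkQ I 1))).comap (c.f.flip q)) (fun z p => ?_) p
    obtain ⟨t, rfl⟩ := φ.surjective z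
    refine generates_mk (((LinearMap.ker ((TensorProduct.mk k A (k ⧸ I)).flip
      (Submodule.mkQ I 1))).comap (c.f.flip q)).comap (bi.flip p ∘ₗ φ.toLinearMap))
      (fun x η => ?_) t
    change c.f (c.biaction (φ (x ⊗ₜ η)) p) q ⊗ₜ[k] Submodule.mkQ I 1 = 0
    rw [hμ, map_smul, LinearMap.smul_apply, TensorProduct.smul_tmul, ← map_smul, smul_eq_mul,
      mul_one, (Submodule.mkQ_apply _ _).trans ((Submodule.Quotient.mk_eq_zero I).2
        (LinearMap.mem_range_self μ _)), TensorProduct.tmul_zero]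
  have h₂ : Submodule.mkQ I (1 : k) = 0 := (hA.unit_bijective (k ⧸ I)).1 <| by
    rw [map_zero]
    exact Subtype.ext (LinearMap.ext h₁)
  have h₃ : (1 : k) ∈ I := (Submodule.Quotient.mk_eq_zero I).1 h₂
  exact LinearMap.range_eq_top.1 ((Ideal.eq_top_iff_one I).2 h₃)

theorem isElementary_of_linearEquiv (hA : IsTaylorAzumaya k A)
    (φ : c.P.carrier ⊗[k] N ≃ₗ[k] A ⊗[k] Bᵐᵒᵖ) (ν : Representation k G N)
    (hφz : ∀ z x η, φ (c.biaction z x ⊗ₜ η) = z * φ (x ⊗ₜ η))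
    (hφg : ∀ g x η, φ (c.P.rep g x ⊗ₜ ν g η) = (α.tensor β.op).rep g (φ (x ⊗ₜ η))) :
    IsElementary (α.tensor β.op) := by
  have := hA.faithful
  let bi : A ⊗[k] Bᵐᵒᵖ →ₗ[k] Module.End k c.P.carrier := c.biaction
  have hμ : ∀ η p, ∃ r : k, ∀ x, c.biaction (φ (x ⊗ₜ η)) p = r • x := fun η p => by
    refine c.exists_scalar hA (bi.flip p ∘ₗ φ.toLinearMap ∘ₗ
      (TensorProduct.mk k c.P.carrier N).flip η) fun z x => ?_
    change c.biaction (φ (c.biaction z x ⊗ₜ η)) p = c.biaction z (c.biaction (φ (x ⊗ₜ η)) p)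
    rw [hφz, map_mul]
    rfl
  -- x ↦ φ(x ⊗ η)p commutes with A ⊗ Bᵒᵖ because φ does, so it is a scalar.
  choose r hr using hμ
  let μ : N ⊗[k] c.P.carrier →ₗ[k] k := TensorProduct.lift (LinearMap.mk₂ k r
    (fun η θ p => c.eq_of_forall_smul_eq fun x => by
      rw [← hr, add_smul, ← hr, ← hr, TensorProduct.tmul_add, map_add, map_add,
        LinearMap.add_apply])
    (fun s η p => c.eq_of_forall_smul_eq fun x => by
      rw [← hr, smul_eq_mul, mul_smul, ← hr, TensorProduct.tmul_smul, map_smul, map_smul,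
        LinearMap.smul_apply])
    (fun η p q => c.eq_of_forall_smul_eq fun x => by
      rw [← hr, add_smul, ← hr, ← hr, map_add])
    (fun s η p => c.eq_of_forall_smul_eq fun x => by
      rw [← hr, smul_eq_mul, mul_smul, ← hr, map_smul]))
  have hμ : ∀ η p x, c.biaction (φ (x ⊗ₜ η)) p = μ (η ⊗ₜ p) • x := fun η p x => hr η p x
  have hsurj := c.pairing_surjective hA φ μ hμ
  -- φ(x ⊗ η)φ(y ⊗ θ) = φ(φ(x ⊗ η)y ⊗ θ) = μ(η ⊗ y)φ(x ⊗ θ), the product of an elementary algebra.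
  have hmul : ∀ x y η θ, φ (μ (η ⊗ₜ y) • x ⊗ₜ θ) = φ (x ⊗ₜ η) * φ (y ⊗ₜ θ) :=
    fun x y η θ => by rw [← hφz, hμ, TensorProduct.smul_tmul']
  let D : GDualPair k G :=
    { M := c.P.carrier
      M' := N
      μ := μ
      surjective := hsurj
      rep := c.P.rep
      rep' := ν
      invariant := fun g η p => c.eq_of_forall_smul_eq fun x => by
        -- Writing x = g(g⁻¹x) turns φ(x ⊗ gη)(gp) into g(φ(g⁻¹x ⊗ η)p) = μ(η ⊗ p)x.
        rw [← hμ, ← Representation.self_inv_apply c.P.rep g x, hφg, ← biaction_equivariant, hμ,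
          map_smul] }
  let e : D.algAction.Iso (α.tensor β.op) :=
    { toEquiv := φ
      map_mul := LinearMap.congr_fun₂
        (f := (LinearMap.mul k (Elem D.toDualPair)).compr₂ φ.toLinearMap)
        (g := (LinearMap.mul k (A ⊗[k] Bᵐᵒᵖ)).compl₁₂ φ.toLinearMap φ.toLinearMap)
        ((Elem.generates D.toDualPair).ext fun x η => (Elem.generates D.toDualPair).ext
          fun y θ =>
             (congrArg φ (Elem.tmul_mul_tmul D.toDualPair x y η θ)).trans (hmul x y η θ))
      equivariant := fun g x => LinearMap.congr_fun
        (f := φ.toLinearMap ∘ₗ D.algAction.rep g)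
        (g := (α.tensor β.op).rep g ∘ₗ φ.toLinearMap)
        ((Elem.generates D.toDualPair).ext fun x η => hφg g x η) x }
  exact ⟨D, ⟨e.symm⟩⟩

theorem isElementary (hA : IsTaylorAzumaya k A) (hB : IsUnitalAlgebra k B)
    (hP : IsFirm c.P.left) (hQ : IsFirm c.Q.right) : IsElementary (α.tensor β.op) := by
  have hA' : IsFirm (NonUnitalAlgHom.lmul k A) := IsUnitalLeft.isFirm hA.unital
  obtain ⟨φ, hφ⟩ := c.exists_dualEquiv hA hB hP hQ
  have hφz : ∀ z x η, φ (c.biaction z x ⊗ₜ η) = z * φ (x ⊗ₜ η) := fun z x η => by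
    refine LinearMap.congr_fun₂
      (f := (c.biaction : A ⊗[k] Bᵐᵒᵖ →ₗ[k] Module.End k c.P.carrier).compr₂
        (φ.toLinearMap ∘ₗ (TensorProduct.mk k c.P.carrier c.dual).flip η))
      (g := (LinearMap.mul k (A ⊗[k] Bᵐᵒᵖ)).compl₂
        (φ.toLinearMap ∘ₗ (TensorProduct.mk k c.P.carrier c.dual).flip η))
      (TensorProduct.ext' fun a b => c.P_generates.ext fun d p => ?_) z x
    change φ (c.P.left a (c.P.right b (c.P.left d p)) ⊗ₜ η) = (a ⊗ₜ b) * φ (c.P.left d p ⊗ₜ η)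
    -- Elements are brought to the form (ad)(pb), on which φ is given by its defining formula.
    have h₁ : c.P.left a (c.P.right b (c.P.left d p)) = c.P.left (a * d) (c.P.right b p) := by
      rw [← c.P.comm, map_mul]
      rfl
    rw [h₁, hφ, hφ, c.dual_mul_left hA'.generates, contract_mul]
  have hφg : ∀ g x η, φ (c.P.rep g x ⊗ₜ c.dualRep g η) = (α.tensor β.op).rep g (φ (x ⊗ₜ η)) :=
    fun g x η => by
      refine LinearMap.congr_fun (f := φ.toLinearMap ∘ₗ
          (TensorProduct.mk k c.P.carrier c.dual).flip (c.dualRep g η) ∘ₗ c.P.rep g)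
        (g := (α.tensor β.op).rep g ∘ₗ φ.toLinearMap ∘ₗ
          (TensorProduct.mk k c.P.carrier c.dual).flip η) (c.P_generates.ext fun a p => ?_) x
      change φ (c.P.rep g (c.P.left a p) ⊗ₜ c.dualRep g η) =
        (α.tensor β.op).rep g (φ (c.P.left a p ⊗ₜ η))
      rw [c.P.rep_left, hφ, hφ, dualRep_apply, contract_equivariant]
  exact c.isElementary_of_linearEquiv (N := c.dual) hA φ c.dualRep hφz hφg

end PreContext

/-- The regular bimodule. -/
def regularBimodule (β : AlgAction k G B) : PreBimodule β β where
  carrier := B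
  left := NonUnitalAlgHom.lmul k B
  right := rightRegular k B
  comm a b p := (mul_assoc a p b.unop).symm
  rep := β.rep
  rep_left := β.map_mul
  rep_right g b p := β.map_mul g p b

/-- The identity context. -/
def PreContext.refl (β : AlgAction k G B) (hB : ActionGenerates (NonUnitalAlgHom.lmul k B)) :
    PreContext β β where
  P := regularBimodule β
  Q := regularBimodule β
  f := LinearMap.mul k B
  h := LinearMap.mul k B
  f_balanced b p q := mul_assoc (G := B) p b q
  h_balanced b p q := mul_assoc (G := B) p b q
  f_left := mul_assoc (G := B)
  f_right a p q := (mul_assoc (G := B) p q a).symm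
  h_left := mul_assoc (G := B)
  h_right a p q := (mul_assoc (G := B) p q a).symm
  f_equivariant g p q := (β.map_mul g p q).symm
  h_equivariant g p q := (β.map_mul g p q).symm
  assoc_P q p q' := mul_assoc (G := B) q p q'
  assoc_Q q p q' := mul_assoc (G := B) q p q'
  P_generates := hB
  Q_generates := hB
  f_generates := hB
  h_generates := hB

/-- The context underlying a strict context between unital algebras. -/
def StrictGMoritaContext.toPreContext (c : StrictGMoritaContext α β) : PreContext α β where
  P := { c.P with }
  Q := { c.Q with }
  f := (btmulBilin c.P.right c.Q.left).compr₂ c.f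
  h := (btmulBilin c.Q.right c.P.left).compr₂ c.h
  f_balanced b p q := congrArg c.f (btmul_balanced _ _ b p q)
  h_balanced b p q := congrArg c.h (btmul_balanced _ _ b p q)
  f_left := c.f_left
  f_right := c.f_right
  h_left := c.h_left
  h_right := c.h_right
  f_equivariant := c.f_equivariant
  h_equivariant := c.h_equivariant
  assoc_P := c.assoc_P
  assoc_Q := c.assoc_Q
  P_generates := c.P.unital_left.isFirm.generates
  Q_generates := c.Q.unital_left.isFirm.generates
  f_generates S hS a := by
    obtain ⟨t, rfl⟩ := c.f_bijective.2 a
    exact generates_btmul _ _ (S.comap c.f) hS t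
  h_generates S hS a := by
    obtain ⟨t, rfl⟩ := c.h_bijective.2 a
    exact generates_btmul _ _ (S.comap c.h) hS t

/-- Here P = Q = B with multiplication as both pairings. Left and right unitality of the regular
bimodule are the same condition on B ⊗_B B → B. -/
theorem isElementary_enveloping (β : AlgAction k G B) (hB : IsTaylorAzumaya k B) :
    IsElementary (β.tensor β.op) :=
  have hB' : IsFirm (NonUnitalAlgHom.lmul k B) := IsUnitalLeft.isFirm hB.unital
  (PreContext.refl β hB'.generates).isElementary hB hB.unital hB'
    (IsUnitalRight.isFirm (σ := rightRegular k B) hB.unital)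

end Dual

end EquivariantBrauer

theorem proposition2p1 {k : Type u} [CommRing k] {G : Type v} [Group G] {A B : Type u}
    [NonUnitalRing A] [Module k A] [IsScalarTower k A A] [SMulCommClass k A A]
    [NonUnitalRing B] [Module k B] [IsScalarTower k B B] [SMulCommClass k B B]
    (α : EquivariantBrauer.AlgAction k G A) (β : EquivariantBrauer.AlgAction k G B)
    (hA : EquivariantBrauer.IsTaylorAzumaya k A) (hB : EquivariantBrauer.IsTaylorAzumaya k B) :
    List.TFAE [
      Nonempty (EquivariantBrauer.StrictGMoritaContext α β),
      EquivariantBrauer.IsElementary (α.tensor β.op),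
      ∃ M N : EquivariantBrauer.GDualPair k G,
        Nonempty ((α.tensor M.algAction).Iso (β.tensor N.algAction))] := by
  tfae_have 1 → 2 := fun ⟨c⟩ =>
    c.toPreContext.isElementary hA hB.unital c.P.unital_left.isFirm c.Q.unital_right.isFirm
  tfae_have 2 → 3 := fun ⟨M, ⟨e⟩⟩ => by
    obtain ⟨N, ⟨e'⟩⟩ := EquivariantBrauer.isElementary_enveloping β hB
    -- A ⊗ E(N) ≅ A ⊗ (B ⊗ Bᵒᵖ) ≅ B ⊗ (A ⊗ Bᵒᵖ) ≅ B ⊗ E(M); hence the pairs appear in exchanged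
    -- order.
    exact ⟨N, M, ⟨((e'.symm.lTensor α).trans (.leftComm α β β.op)).trans (e.lTensor β)⟩⟩
  tfae_have 3 → 1 := fun ⟨M, N, ⟨e⟩⟩ =>
    EquivariantBrauer.strictContext_of_iso hA.unital hB.unital M N e
  tfae_finish
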